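/- Let $n>2$ and let $C$ be a right-angled polytope in hyperbolic space $\mathbb{H}^n$, that is, an $n$-dimensional finite-sided convex polyhedron in $\mathbb{H}^n$ which is the convex hull of finitely many actual and ideal points and in which any two sides (faces of codimension one) that meet in a face of codimension two meet at dihedral angle $\pi/2$. Let $\Gamma\le\mathrm{Isom}(\mathbb{H}^n)$ be the group generated by the reflections in the sides of $C$, and let $\Delta$ be the graph with one vertex for each side of $C$ and an edge between two vertices if the corresponding sides meet at a right angle. Then $\Gamma$ is the right-angled Coxeter group $$\Gamma=\langle r\in V(\Delta) : r^2=1,\ (rs)^2=1 \text{ if } (r,s)\in E(\Delta)\rangle,$$ where the generator $r$ is realized by the reflection in the corresponding side. Moreover: 1. Let $A\subseteq V(\Delta)$ and $B=V(\Delta)\setminus A$, let $\Gamma_A,\Gamma_B\le\Gamma$ be the subgroups generated by the elements of $A$ and of $B$, and let $N(\Gamma_B)$ be the normal closure of $\Gamma_B$ in $\Gamma$. Then $\Gamma/N(\Gamma_B)=\Gamma_A$; precisely, there is an isomorphism $\Gamma/N(\Gamma_B)\to\Gamma_A$ sending $gN(\Gamma_B)$ to $g$ for every $g\in\Gamma_A$.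 In particular there is a homomorphism $\Gamma\to\Gamma_A$ that is the identity on $\Gamma_A$. 2. Let $F$ be a face of $C$ of dimension $n-k\ge 2$, let $\mathbb{H}^{n-k}\subseteq\mathbb{H}^n$ be the totally geodesic subspace spanned by $F$, and let $\Gamma_F\le\mathrm{Isom}(\mathbb{H}^{n-k})$ be the group generated by the reflections of $\mathbb{H}^{n-k}$ in the sides of $F$. Then $\Gamma$ retracts onto $\Gamma_F$: there are homomorphisms $\iota:\Gamma_F\to\Gamma$ and $\rho:\Gamma\to\Gamma_F$ with $\rho\circ\iota=\mathrm{id}$, where $\iota(g)$ preserves $\mathbb{H}^{n-k}$ and restricts to $g$ on it, for every $g\in\Gamma_F$. -/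

import Mathlib

namespace HypPoly

/-- The vector space underlying Minkowski space `ℝ^{n,1}`, with coordinates `x 0, …, x n`. -/
abbrev Mink (n : ℕ) : Type := Fin (n + 1) → ℝ

/-- The Lorentzian form `-x₀y₀ + x₁y₁ + ⋯ + xₙyₙ`. -/
def lorentz {n : ℕ} (x y : Mink n) : ℝ :=
  -(x 0 * y 0) + ∑ i : Fin n, x i.succ * y i.succ

/-- The positive sheet of the hyperboloid, i.e. the hyperboloid model of hyperbolic `n`-space. -/
def hyperboloid (n : ℕ) : Set (Mink n) := {x | lorentz x x = -1 ∧ 0 < x 0}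

/-- The hyperbolic distance on the hyperboloid model. -/
noncomputable def hdist {n : ℕ} (x y : Mink n) : ℝ := Real.arcosh (-(lorentz x y))

/-- The part of hyperbolic space lying in a linear subspace `W`.  For `W = ⊤` it is all of
hyperbolic `n`-space; if it is non-empty it is a totally geodesic copy of hyperbolic space of
dimension `dim W - 1`. -/
def hypSubspace {n : ℕ} (W : Submodule ℝ (Mink n)) : Set (Mink n) :=
  {x | x ∈ hyperboloid n ∧ x ∈ W}

/-- The inclusion of `hypSubspace W` into hyperbolic `n`-space. -/
def toHyp {n : ℕ} {W : Submodule ℝ (Mink n)} (x : hypSubspace W) :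
    hypSubspace (⊤ : Submodule ℝ (Mink n)) :=
  ⟨x.1, x.2.1, Submodule.mem_top⟩

/-- The isometry group of a set of points of the hyperboloid model, for the hyperbolic distance:
all bijections that preserve the distance. -/
def Isom {n : ℕ} (X : Set (Mink n)) : Subgroup (Equiv.Perm X) where
  carrier := {g | ∀ x y : X, hdist (g x : Mink n) (g y : Mink n) = hdist (x : Mink n) (y : Mink n)}
  mul_mem' := by
    intro a b ha hb x y
    exact (ha (b x) (b y)).trans (hb x y)
  one_mem' := by
    intro x y
    rfl
  inv_mem' := by
    intro a ha x y
    have h := ha (a⁻¹ x) (a⁻¹ y)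
    simpa using h.symm

/-- The dimension of a non-empty subset of the hyperboloid: the dimension of the smallest
totally geodesic subspace that contains it. -/
noncomputable def hdim {n : ℕ} (S : Set (Mink n)) : ℕ :=
  Module.finrank ℝ (Submodule.span ℝ S) - 1

/-- A (full-dimensional) polytope in hyperbolic `n`-space: a finite intersection of closed
half-spaces, of dimension `n`, which is the convex hull of a finite set `V` of actual points (on
the hyperboloid) and ideal points (future-directed light-like vectors). In the hyperboloid model
the convex hull of `V` consists of the points that are non-negative linear combinations of `V`. -/
structure IsPolytope {n : ℕ} (C : Set (Mink n)) : Prop where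
  polyhedron : ∃ N : Finset (Mink n), (∀ u ∈ N, 0 < lorentz u u) ∧
    C = {x | x ∈ hyperboloid n ∧ ∀ u ∈ N, lorentz u x ≤ 0}
  hull : ∃ V : Finset (Mink n),
    (∀ v ∈ V, v ∈ hyperboloid n ∨ (lorentz v v = 0 ∧ 0 < v 0)) ∧
    C = {x | x ∈ hyperboloid n ∧
      ∃ c : Mink n → ℝ, (∀ v ∈ V, 0 ≤ c v) ∧ x = ∑ v ∈ V, c v • v}
  fullDim : Submodule.span ℝ C = ⊤

/-- `F` is a (non-empty) face of `C`: the intersection of `C` with a hyperplane `u^⊥` such that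
`C` lies on one side of it. The value `u = 0` gives the improper face `C`. -/
def IsFace {n : ℕ} (C F : Set (Mink n)) : Prop :=
  F.Nonempty ∧ ∃ u : Mink n, (∀ x ∈ C, lorentz u x ≤ 0) ∧ F = {x | x ∈ C ∧ lorentz u x = 0}

/-- `S` is a side of `C`, i.e. a face of codimension one. -/
def IsFacet {n : ℕ} (C S : Set (Mink n)) : Prop :=
  IsFace C S ∧ hdim S + 1 = hdim C

/-- The type of sides of `C`. -/
def Facet {n : ℕ} (C : Set (Mink n)) : Type := {S : Set (Mink n) // IsFacet C S}

/-- `e` is the outward unit normal vector of `C` along `S`, in the subspace spanned by `C`. -/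
def IsOutwardNormal {n : ℕ} (C S : Set (Mink n)) (e : Mink n) : Prop :=
  e ∈ Submodule.span ℝ C ∧ lorentz e e = 1 ∧
    (∀ x ∈ C, lorentz e x ≤ 0) ∧ ∀ x ∈ S, lorentz e x = 0

/-- Two distinct sides of `C` are adjacent if they meet in a face of codimension two. -/
def Adjacent {n : ℕ} (C S T : Set (Mink n)) : Prop :=
  S ≠ T ∧ (S ∩ T).Nonempty ∧ hdim (S ∩ T) + 2 = hdim C

/-- The dihedral angle along `S ∩ T` of `C` equals `θ`: it is `π` minus the angle between the
outward normals, i.e. `arccos (-⟨e, f⟩)`. -/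
def HasDihedralAngle {n : ℕ} (C S T : Set (Mink n)) (θ : ℝ) : Prop :=
  ∃ e f : Mink n, IsOutwardNormal C S e ∧ IsOutwardNormal C T f ∧
    θ = Real.arccos (-(lorentz e f))

/-- Two sides meet at a right angle. -/
def MeetAtRightAngle {n : ℕ} (C S T : Set (Mink n)) : Prop :=
  Adjacent C S T ∧ HasDihedralAngle C S T (Real.pi / 2)

/-- `C` is right-angled: any two sides that meet in a face of codimension two meet at a right
angle. (Sides that meet only at an ideal point, i.e. at angle `0`, are allowed, and there is no
condition on sides that do not meet.) -/
def IsRightAngled {n : ℕ} (C : Set (Mink n)) : Prop :=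
  ∀ S T : Set (Mink n), IsFacet C S → IsFacet C T → Adjacent C S T →
    HasDihedralAngle C S T (Real.pi / 2)

/-- `g` is the reflection of the hyperbolic space `hypSubspace W` in the hyperplane through `S`,
`x ↦ x - 2⟨e, x⟩e` with `e ∈ W` a unit normal vector of `S`. -/
def IsReflectionIn {n : ℕ} (W : Submodule ℝ (Mink n)) (S : Set (Mink n))
    (g : Isom (hypSubspace W)) : Prop :=
  ∃ e ∈ W, lorentz e e = 1 ∧ (∀ x ∈ S, lorentz e x = 0) ∧
    ∀ x : hypSubspace W,
      ((g : Equiv.Perm (hypSubspace W)) x : Mink n) = (x : Mink n) - (2 * lorentz e x) • e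

/-- The group of isometries of `hypSubspace W` generated by the reflections in the sides of a
polytope `C` of that space. -/
def reflectionGroup {n : ℕ} (W : Submodule ℝ (Mink n)) (C : Set (Mink n)) :
    Subgroup (Isom (hypSubspace W)) :=
  Subgroup.closure {g | ∃ S : Facet C, IsReflectionIn W S.1 g}

/-- The reflection group `Γ` in `Isom(ℍⁿ)` of a polytope `C` of `ℍⁿ`. -/
abbrev Gam {n : ℕ} (C : Set (Mink n)) : Subgroup (Isom (hypSubspace (⊤ : Submodule ℝ (Mink n)))) :=
  reflectionGroup ⊤ C

/-- The reflection group `Γ_F` of a face `F`, a group of isometries of the hyperbolic space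
spanned by `F`, generated by the reflections in the sides of `F`. -/
abbrev faceGroup {n : ℕ} (F : Set (Mink n)) :
    Subgroup (Isom (hypSubspace (Submodule.span ℝ F))) :=
  reflectionGroup (Submodule.span ℝ F) F

/-- The special subgroup `Γ_A` of `Γ`, generated by the reflections in the sides in `A`. -/
def special {n : ℕ} (C : Set (Mink n)) (A : Set (Facet C)) : Subgroup (Gam C) :=
  Subgroup.closure {g | ∃ S ∈ A, IsReflectionIn ⊤ S.1 (g : Isom (hypSubspace ⊤))}

theorem lorentz_comm {n : ℕ} (x y : Mink n) : lorentz x y = lorentz y x := by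
  simp only [lorentz, mul_comm]

theorem meetAtRightAngle_symm {n : ℕ} {C S T : Set (Mink n)} (h : MeetAtRightAngle C S T) :
    MeetAtRightAngle C T S := by
  obtain ⟨⟨h1, h2, h3⟩, e, f, he, hf, h4⟩ := h
  refine ⟨⟨h1.symm, ?_, ?_⟩, f, e, hf, he, ?_⟩
  · rwa [Set.inter_comm]
  · rwa [Set.inter_comm]
  · rwa [lorentz_comm]

open Classical in
/-- The right-angled Coxeter matrix of the graph `Δ` whose vertices are the sides of `C`, two of
them being joined by an edge if they meet at a right angle. (An entry `0` stands for `∞`, i.e. no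
relation.) Its Coxeter group is `⟨r ∈ V(Δ) : r² = 1, (rs)² = 1 if (r,s) ∈ E(Δ)⟩`. -/
noncomputable def coxeterMatrix {n : ℕ} (C : Set (Mink n)) : CoxeterMatrix (Facet C) where
  M := Matrix.of fun S T => if S = T then 1 else if MeetAtRightAngle C S.1 T.1 then 2 else 0
  isSymm := by
    ext S T
    have h : MeetAtRightAngle C T.1 S.1 ↔ MeetAtRightAngle C S.1 T.1 :=
      ⟨meetAtRightAngle_symm, meetAtRightAngle_symm⟩
    simp only [Matrix.transpose_apply, Matrix.of_apply, h, eq_comm (a := T) (b := S)]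
  diagonal := by
    intro S
    simp
  off_diagonal := by
    intro S T hST
    simp only [Matrix.of_apply, if_neg hST]
    split_ifs <;> decide

end HypPoly

namespace HypPoly

open Filter Topology

variable {n : ℕ} {C : Set (Mink n)}

/-! Everything is read off from the outward unit normals of the sides in Minkowski space. The
geometric core is a dichotomy: the normals of two distinct sides are orthogonal if the sides are
adjacent, and otherwise pair to at most `-1`, so that their hyperplanes do not cross
(`normal_lorentz_nonpos`, `adjacent_of_lorentz_normal`). It is proved by projecting points of `C`
orthogonally: since adjacent sides meet at right angles, the projection of a point to the hyperplane
of a side `T` still satisfies the inequalities of the sides adjacent to `T`, and these alone cut out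
`T` in its hyperplane (`polyhedron_reduction`).

The dichotomy says that the reflections satisfy the right-angled Coxeter relations. There are no
further relations, by ping-pong on half-spaces with induction on word length
(`lorentz_neg_of_not_isLeftDescent`, `toIsom_injective`).

The quotient statement is then pure algebra: in a right-angled Coxeter group, sending the generators
outside `A` to `1` respects all relations.

For a face `F`, let `T` be a side that meets `F` without containing it. Its normal is orthogonal to
the normals of all sides containing `F`, hence lies in the span of `F` (`normal_mem_span_face`). So
the reflection in `T` preserves that span and restricts there to the reflection in `T ∩ F`. All
sides of `F` arise in this way (`exists_facet_inter`). Ping-pong inside the span of `F` therefore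
identifies the reflection group of `F` with the Coxeter group on these `T`, and deleting the other
generators gives the retraction. -/

/-- Pairing with `u` under the Lorentzian form, as a linear functional. -/
def lorentzFunctional (u : Mink n) : Mink n →ₗ[ℝ] ℝ where
  toFun x := lorentz u x
  map_add' x y := by
    simp only [lorentz, Pi.add_apply, mul_add, Finset.sum_add_distrib]
    ring
  map_smul' c x := by
    simp only [lorentz, Pi.smul_apply, smul_eq_mul, RingHom.id_apply, mul_add, Finset.mul_sum,
      mul_neg, mul_left_comm]

@[simp] theorem lorentz_add_right (u x y : Mink n) :
    lorentz u (x + y) = lorentz u x + lorentz u y := (lorentzFunctional u).map_add x y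

@[simp] theorem lorentz_smul_right (u : Mink n) (c : ℝ) (x : Mink n) :
    lorentz u (c • x) = c * lorentz u x := (lorentzFunctional u).map_smul c x

@[simp] theorem lorentz_neg_right (u x : Mink n) : lorentz u (-x) = -lorentz u x :=
  (lorentzFunctional u).map_neg x

@[simp] theorem lorentz_sub_right (u x y : Mink n) :
    lorentz u (x - y) = lorentz u x - lorentz u y := (lorentzFunctional u).map_sub x y

@[simp] theorem lorentz_zero_right (u : Mink n) : lorentz u 0 = 0 := (lorentzFunctional u).map_zero

@[simp] theorem lorentz_add_left (x y u : Mink n) :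
    lorentz (x + y) u = lorentz x u + lorentz y u := by
  simp only [lorentz_comm _ u, lorentz_add_right]

@[simp] theorem lorentz_smul_left (c : ℝ) (x u : Mink n) :
    lorentz (c • x) u = c * lorentz x u := by
  simp only [lorentz_comm _ u, lorentz_smul_right]

@[simp] theorem lorentz_neg_left (x u : Mink n) : lorentz (-x) u = -lorentz x u := by
  simp only [lorentz_comm _ u, lorentz_neg_right]

@[simp] theorem lorentz_sub_left (x y u : Mink n) :
    lorentz (x - y) u = lorentz x u - lorentz y u := by
  simp only [lorentz_comm _ u, lorentz_sub_right]

@[simp] theorem lorentz_zero_left (u : Mink n) : lorentz 0 u = 0 := by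
  rw [lorentz_comm, lorentz_zero_right]

theorem lorentz_self (x : Mink n) : lorentz x x = -(x 0) ^ 2 + ∑ i : Fin n, x i.succ ^ 2 := by
  simp only [lorentz, sq]

theorem eq_zero_of_forall_lorentz {u : Mink n} (h : ∀ x, lorentz u x = 0) : u = 0 := by
  funext i
  refine Fin.cases ?_ (fun j => ?_) i
  · simpa [lorentz] using h (Pi.single 0 1)
  · simpa [lorentz, Pi.single_apply, Fin.succ_ne_zero, (Fin.succ_ne_zero _).symm,
      Fin.succ_inj] using h (Pi.single j.succ 1)

/-! ### Causal geometry of Minkowski space. -/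

/-- A non-zero vector orthogonal to a time-like vector is space-like. -/
theorem lorentz_self_pos_of_orthogonal {u y : Mink n} (hy : lorentz y y < 0)
    (h : lorentz u y = 0) (hu : u ≠ 0) : 0 < lorentz u u := by
  rw [lorentz_self] at hy ⊢
  have hcs := Finset.sum_mul_sq_le_sq_mul_sq Finset.univ (fun i : Fin n => u i.succ)
    (fun i : Fin n => y i.succ)
  have h' : ∑ i : Fin n, u i.succ * y i.succ = u 0 * y 0 := by
    simp only [lorentz] at h
    linarith
  rw [h'] at hcs
  have hB : 0 ≤ ∑ i : Fin n, y i.succ ^ 2 := Finset.sum_nonneg fun i _ => sq_nonneg _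
  have hA : 0 ≤ ∑ i : Fin n, u i.succ ^ 2 := Finset.sum_nonneg fun i _ => sq_nonneg _
  rcases hA.eq_or_lt with hA0 | hA0
  · have hs : ∀ i : Fin n, u i.succ = 0 := fun i => by
      have := (Finset.sum_eq_zero_iff_of_nonneg (fun i _ => sq_nonneg _)).1 hA0.symm i
        (Finset.mem_univ i)
      simpa using this
    have hy0 : y 0 ≠ 0 := by
      intro h0
      rw [h0] at hy
      linarith
    have h0 : u 0 = 0 := by
      have : u 0 * y 0 = 0 := by rw [← h']; simp [hs]
      simpa [hy0] using this
    exact absurd (funext fun i => Fin.cases h0 hs i) hu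
  · by_contra hcon
    -- With `A`, `B` the spatial square sums of `u`, `y`, the contradiction is `(u₀y₀)² ≤ AB < Ay₀²
    -- ≤ u₀²y₀²`.
    nlinarith [mul_pos hA0 (show 0 < y 0 ^ 2 - ∑ i : Fin n, y i.succ ^ 2 by linarith),
      mul_nonneg (sq_nonneg (y 0))
        (show 0 ≤ u 0 ^ 2 - ∑ i : Fin n, u i.succ ^ 2 by linarith)]

/-- The open cone of future-directed time-like vectors. -/
def futureCone (n : ℕ) : Set (Mink n) := {x | lorentz x x < 0 ∧ 0 < x 0}

theorem hyperboloid_subset_futureCone : hyperboloid n ⊆ futureCone n :=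
  fun x hx => ⟨by rw [hx.1]; norm_num, hx.2⟩

/-- Cauchy–Schwarz bounds the spatial part of the pairing strictly by the product of the time
coordinates. Light-like `y` must be allowed: such vectors arise as sums of normals of sides tangent
at infinity. -/
theorem lorentz_neg_of_causal {x y : Mink n} (hx : x ∈ futureCone n) (hy : lorentz y y ≤ 0)
    (hy0 : 0 < y 0) : lorentz y x < 0 := by
  obtain ⟨hx, hx0⟩ := hx
  rw [lorentz_self] at hx hy
  have hcs := Finset.sum_mul_sq_le_sq_mul_sq Finset.univ (fun i : Fin n => y i.succ)
    (fun i : Fin n => x i.succ)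
  have hB : 0 ≤ ∑ i : Fin n, x i.succ ^ 2 := Finset.sum_nonneg fun i _ => sq_nonneg _
  have h1 : (∑ i : Fin n, y i.succ * x i.succ) ^ 2 < (y 0 * x 0) ^ 2 := by
    have := mul_nonneg hB (show 0 ≤ y 0 ^ 2 - ∑ i : Fin n, y i.succ ^ 2 by linarith)
    have := mul_pos (pow_pos hy0 2) (show 0 < x 0 ^ 2 - ∑ i : Fin n, x i.succ ^ 2 by linarith)
    nlinarith
  have h2 := abs_lt_of_sq_lt_sq h1 (mul_pos hy0 hx0).le
  simp only [lorentz]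
  linarith [(abs_lt.1 h2).2]

theorem futureCone_nonzero {x : Mink n} (hx : x ∈ futureCone n) : x ≠ 0 := by
  rintro rfl
  exact lt_irrefl _ hx.2

/-- A non-zero causal vector is either future-directed or past-directed. -/
theorem causal_sign {u : Mink n} (hu : u ≠ 0) (h : lorentz u u ≤ 0) :
    (∀ x ∈ futureCone n, lorentz u x < 0) ∨ ∀ x ∈ futureCone n, 0 < lorentz u x := by
  rcases lt_trichotomy (u 0) 0 with h0 | h0 | h0
  · right
    intro x hx
    have := lorentz_neg_of_causal hx (y := -u) (by simpa using h) (by simpa using h0)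
    simpa using this
  · exfalso
    rw [lorentz_self, h0] at h
    have h1 : ∑ i : Fin n, u i.succ ^ 2 = 0 :=
      le_antisymm (by linarith) (Finset.sum_nonneg fun i _ => sq_nonneg _)
    have hs : ∀ i : Fin n, u i.succ = 0 := fun i => by
      simpa using (Finset.sum_eq_zero_iff_of_nonneg (fun i _ => sq_nonneg _)).1 h1 i
        (Finset.mem_univ i)
    exact hu (funext fun i => Fin.cases h0 hs i)
  · left
    intro x hx
    exact lorentz_neg_of_causal hx h h0

theorem lorentz_neg_of_future {x y : Mink n} (hx : x ∈ futureCone n) (hy : y ∈ futureCone n) :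
    lorentz x y < 0 := lorentz_neg_of_causal hy hx.1.le hx.2

/-- A past-directed time-like vector would pair positively with `x`. This keeps projections and
reflections on the right sheet. -/
theorem mem_futureCone_of_lorentz_neg {x z : Mink n} (hx : x ∈ futureCone n)
    (hz : lorentz z z < 0) (hxz : lorentz x z < 0) : z ∈ futureCone n := by
  refine ⟨hz, ?_⟩
  by_contra hcon
  rcases (not_lt.1 hcon).lt_or_eq with h0 | h0
  · have := lorentz_neg_of_causal hx (y := -z) (by simpa using hz.le) (by simpa using h0)
    rw [lorentz_neg_left, lorentz_comm] at this
    linarith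
  · rw [lorentz_self, h0] at hz
    have : 0 ≤ ∑ i : Fin n, z i.succ ^ 2 := Finset.sum_nonneg fun i _ => sq_nonneg _
    linarith

theorem futureCone_add {x y : Mink n} (hx : x ∈ futureCone n) (hy : y ∈ futureCone n) :
    x + y ∈ futureCone n := by
  refine ⟨?_, add_pos hx.2 hy.2⟩
  have h1 := lorentz_neg_of_future hx hy
  have h2 := lorentz_comm x y
  simp only [lorentz_add_left, lorentz_add_right]
  linarith [hx.1, hy.1]

theorem futureCone_smul {x : Mink n} (hx : x ∈ futureCone n) {t : ℝ} (ht : 0 < t) :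
    t • x ∈ futureCone n := by
  refine ⟨?_, mul_pos ht hx.2⟩
  simp only [lorentz_smul_left, lorentz_smul_right]
  have := mul_pos_of_neg_of_neg hx.1 (neg_lt_zero.2 (mul_pos ht ht))
  nlinarith

theorem exists_smul_mem_hyperboloid {x : Mink n} (hx : x ∈ futureCone n) :
    ∃ t : ℝ, 0 < t ∧ t • x ∈ hyperboloid n := by
  have h : 0 < -lorentz x x := neg_pos.2 hx.1
  have hs := Real.sqrt_pos.2 h
  refine ⟨(√(-lorentz x x))⁻¹, inv_pos.2 hs, ?_, mul_pos (inv_pos.2 hs) hx.2⟩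
  simp only [lorentz_smul_left, lorentz_smul_right]
  have := Real.mul_self_sqrt h.le
  field_simp
  nlinarith

theorem continuous_lorentz {f g : ℝ → Mink n} (hf : Continuous f) (hg : Continuous g) :
    Continuous fun t => lorentz (f t) (g t) := by
  unfold lorentz
  fun_prop

/-- Finitely many strict inequalities persist under small perturbations. -/
theorem exists_perturbation {x : Mink n} (hx : x ∈ futureCone n) (d : Mink n)
    {J : Set (Mink n)} (hJ : J.Finite) (hJx : ∀ u ∈ J, lorentz u x < 0) :
    ∃ ε : ℝ, 0 < ε ∧ x + ε • d ∈ futureCone n ∧ ∀ u ∈ J, lorentz u (x + ε • d) < 0 := by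
  have hc : Continuous fun ε : ℝ => x + ε • d := by fun_prop
  have h1 : ∀ᶠ ε : ℝ in 𝓝 0, lorentz (x + ε • d) (x + ε • d) < 0 :=
    (continuous_lorentz hc hc).continuousAt.eventually_lt continuousAt_const (by simpa using hx.1)
  have h2 : ∀ᶠ ε : ℝ in 𝓝 0, 0 < (x + ε • d) 0 :=
    continuousAt_const.eventually_lt (continuous_apply 0 |>.comp hc).continuousAt
      (by simpa using hx.2)
  have h3 : ∀ᶠ ε : ℝ in 𝓝 0, ∀ u ∈ J, lorentz u (x + ε • d) < 0 :=
    (eventually_all_finite hJ).2 fun u hu =>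
      (continuous_lorentz continuous_const hc).continuousAt.eventually_lt continuousAt_const
        (by simpa using hJx u hu)
  have h4 : ∀ᶠ ε : ℝ in 𝓝[>] 0, 0 < ε := eventually_mem_nhdsWithin
  obtain ⟨ε, hε, h5⟩ := (h4.and (((h1.and h2).and h3).filter_mono nhdsWithin_le_nhds)).exists
  exact ⟨ε, hε, h5.1, h5.2⟩

/-! ### Polyhedra, their essential half-spaces, and uniqueness of normals. -/

/-- A convex cone is not covered by finitely many subspaces none of which contains it. -/
theorem exists_mem_cone_notMem {V : Type*} [AddCommGroup V] [Module ℝ V] {Q : Set V}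
    (hne : Q.Nonempty) (hadd : ∀ x ∈ Q, ∀ y ∈ Q, x + y ∈ Q)
    (hsmul : ∀ x ∈ Q, ∀ t : ℝ, 0 < t → t • x ∈ Q) {ι : Type*} {s : Set ι} (hs : s.Finite)
    (W : ι → Submodule ℝ V) (hW : ∀ i ∈ s, ∃ x ∈ Q, x ∉ W i) :
    ∃ x ∈ Q, ∀ i ∈ s, x ∉ W i := by
  induction s, hs using Set.Finite.induction_on with
  | empty => exact ⟨hne.some, hne.some_mem, by simp⟩
  | @insert a s ha hs ih =>
    obtain ⟨x, hxQ, hx⟩ := ih fun i hi => hW i (Set.mem_insert_of_mem a hi)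
    obtain ⟨y, hyQ, hy⟩ := hW a (Set.mem_insert a s)
    -- On the ray `x + t • y` each subspace is met at most once: two hits would put `y`, and then
    -- `x`, into it. Some `t > 0` avoids them all.
    have hbad : ∀ i ∈ insert a s, {t : ℝ | x + t • y ∈ W i}.Subsingleton := by
      intro i hi t ht t' ht'
      by_contra hne
      have hyi : y ∈ W i := by
        have h := (W i).sub_mem ht ht'
        rw [add_sub_add_left_eq_sub, ← sub_smul] at h
        exact ((W i).smul_mem_iff (sub_ne_zero.2 hne)).1 h
      rcases Set.mem_insert_iff.1 hi with rfl | his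
      · exact hy hyi
      · have h := (W i).sub_mem ht ((W i).smul_mem t hyi)
        rw [add_sub_cancel_right] at h
        exact hx i his h
    have hfin : (⋃ i ∈ insert a s, {t : ℝ | x + t • y ∈ W i}).Finite :=
      (hs.insert a).biUnion fun i hi => (hbad i hi).finite
    obtain ⟨t, ht, hts⟩ := (Set.Ioi_infinite (0 : ℝ)).exists_notMem_finite hfin
    refine ⟨x + t • y, hadd _ hxQ _ (hsmul _ hyQ t ht), fun i hi h => hts ?_⟩
    exact Set.mem_biUnion hi h

/-- A polyhedron spanning `E` is cut out in `E` by those of its half-spaces whose boundary meets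
it in codimension one. -/
theorem polyhedron_reduction {E : Submodule ℝ (Mink n)} {N P : Set (Mink n)} (hN : N.Finite)
    (hP : ∀ x, x ∈ P ↔ x ∈ hyperboloid n ∧ x ∈ E ∧ ∀ u ∈ N, lorentz u x ≤ 0)
    (hne : P.Nonempty) (hspan : Submodule.span ℝ P = E) {z : Mink n} (hz : z ∈ futureCone n)
    (hzE : z ∈ E)
    (hzN : ∀ u ∈ N, Module.finrank ℝ E ≤
      Module.finrank ℝ (Submodule.span ℝ {x | x ∈ P ∧ lorentz u x = 0}) + 1 → lorentz u z ≤ 0) :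
    ∀ u ∈ N, lorentz u z ≤ 0 := by
  by_contra! hcon
  obtain ⟨v, hvN, hv⟩ := hcon
  set Q : Set (Mink n) := {x | x ∈ futureCone n ∧ x ∈ E ∧ ∀ u ∈ N, lorentz u x ≤ 0} with hQ
  have hPQ : P ⊆ Q := fun x hx => by
    obtain ⟨h1, h2, h3⟩ := (hP x).1 hx
    exact ⟨hyperboloid_subset_futureCone h1, h2, h3⟩
  -- For a constraint `u` violated by `z`, the slice of `P` by `u^⊥` has codimension at least two in
  -- `E`, so adding `z` still leaves `W u` too small to contain `E`. A generic `x` of the cone over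
  -- `P` thus avoids all `W u`.
  set W : Mink n → Submodule ℝ (Mink n) := fun u =>
    Submodule.span ℝ {x | x ∈ P ∧ lorentz u x = 0} ⊔ Submodule.span ℝ {z}
  set N' : Set (Mink n) := {u | u ∈ N ∧ 0 < lorentz u z}
  have hN' : N'.Finite := hN.subset fun u hu => hu.1
  obtain ⟨x, ⟨hxF, hxE, hxN⟩, hxW⟩ := exists_mem_cone_notMem (Q := Q) (hne.mono hPQ)
    (fun x hx y hy => ⟨futureCone_add hx.1 hy.1, E.add_mem hx.2.1 hy.2.1, fun u hu => by
      rw [lorentz_add_right]; linarith [hx.2.2 u hu, hy.2.2 u hu]⟩)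
    (fun x hx t ht => ⟨futureCone_smul hx.1 ht, E.smul_mem t hx.2.1, fun u hu => by
      rw [lorentz_smul_right]; exact mul_nonpos_of_nonneg_of_nonpos ht.le (hx.2.2 u hu)⟩)
    hN' W (by
      intro u hu
      by_contra! hall
      have hEW : E ≤ W u := by
        rw [← hspan, Submodule.span_le]
        exact fun x hx => hall x (hPQ hx)
      have h1 := Submodule.finrank_mono hEW
      have h2 := Submodule.finrank_add_le_finrank_add_finrank
        (Submodule.span ℝ {x | x ∈ P ∧ lorentz u x = 0}) (Submodule.span ℝ {z})
      have h3 : Module.finrank ℝ (Submodule.span ℝ {z}) = 1 :=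
        finrank_span_singleton (futureCone_nonzero hz)
      have := hzN u hu.1 (by rw [h3] at h2; exact h1.trans h2)
      exact absurd hu.2 (not_lt.2 this))
  -- Travelling from `x` in direction `z`, the constraint `u` is the first to become tight. At that
  -- moment the point lies on the slice of `P` by `u^⊥`, up to scaling, which forces `x ∈ W u`.
  obtain ⟨u, hu, hmin⟩ := Set.exists_min_image N' (fun u => -lorentz u x / lorentz u z) hN'
    ⟨v, hvN, hv⟩
  set τ := -lorentz u x / lorentz u z with hτ
  have hτ0 : 0 ≤ τ := div_nonneg (neg_nonneg.2 (hxN u hu.1)) hu.2.le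
  have hwF : x + τ • z ∈ futureCone n := by
    rcases hτ0.eq_or_lt with h | h
    · rw [← h]; simpa using hxF
    · exact futureCone_add hxF (futureCone_smul hz h)
  obtain ⟨t, ht, htw⟩ := exists_smul_mem_hyperboloid hwF
  have hwE : x + τ • z ∈ E := E.add_mem hxE (E.smul_mem τ hzE)
  have hwu : lorentz u (x + τ • z) = 0 := by
    have := hu.2.ne'
    rw [lorentz_add_right, lorentz_smul_right, hτ]
    field_simp
    ring
  have hwN : ∀ v ∈ N, lorentz v (x + τ • z) ≤ 0 := by
    intro v hv
    rw [lorentz_add_right, lorentz_smul_right]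
    rcases le_or_gt (lorentz v z) 0 with h | h
    · linarith [hxN v hv, mul_nonpos_of_nonneg_of_nonpos hτ0 h]
    · have := (le_div_iff₀ h).1 (hmin v ⟨hv, h⟩)
      linarith
  have hwP : t • (x + τ • z) ∈ P := (hP _).2 ⟨htw, E.smul_mem t hwE, fun v hv => by
    rw [lorentz_smul_right]; exact mul_nonpos_of_nonneg_of_nonpos ht.le (hwN v hv)⟩
  have hwW : x + τ • z ∈ W u := by
    refine (Submodule.smul_mem_iff _ ht.ne').1 (Submodule.mem_sup_left (Submodule.subset_span ?_))
    exact ⟨hwP, by rw [lorentz_smul_right, hwu, mul_zero]⟩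
  refine hxW u hu ?_
  have := (W u).sub_mem hwW ((W u).smul_mem τ
    (Submodule.mem_sup_right (Submodule.mem_span_singleton_self z)))
  rwa [add_sub_cancel_right] at this

theorem lorentz_eq_zero_of_mem_span {e : Mink n} {S : Set (Mink n)}
    (h : ∀ x ∈ S, lorentz e x = 0) {x : Mink n} (hx : x ∈ Submodule.span ℝ S) :
    lorentz e x = 0 := by
  have : Submodule.span ℝ S ≤ LinearMap.ker (lorentzFunctional e) :=
    Submodule.span_le.2 fun y hy => h y hy
  exact this hx

/-- Two unit normal vectors of a hyperplane agree up to sign. -/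
theorem unit_normal_eq_or_eq_neg {W : Submodule ℝ (Mink n)} {S : Set (Mink n)}
    (hSW : S ⊆ W) (hS : ∃ y ∈ S, lorentz y y < 0)
    (hdim : Module.finrank ℝ (Submodule.span ℝ S) + 1 = Module.finrank ℝ W)
    {e e' : Mink n} (he : e ∈ W) (he1 : lorentz e e = 1) (heS : ∀ x ∈ S, lorentz e x = 0)
    (he' : e' ∈ W) (he1' : lorentz e' e' = 1) (heS' : ∀ x ∈ S, lorentz e' x = 0) :
    e' = e ∨ e' = -e := by
  have hnot : e ∉ Submodule.span ℝ S := fun h => by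
    rw [lorentz_eq_zero_of_mem_span heS h] at he1
    exact zero_ne_one he1
  have hle : Submodule.span ℝ S ⊔ Submodule.span ℝ {e} ≤ W :=
    sup_le (Submodule.span_le.2 hSW) (Submodule.span_le.2 (by simpa using he))
  have hlt : Submodule.span ℝ S < Submodule.span ℝ S ⊔ Submodule.span ℝ {e} := by
    refine lt_of_le_of_ne le_sup_left fun h => hnot ?_
    rw [h]
    exact Submodule.mem_sup_right (Submodule.mem_span_singleton_self e)
  have heq := Submodule.eq_of_le_of_finrank_le hle (by
    rw [← hdim]; exact Submodule.finrank_lt_finrank_of_lt hlt)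
  rw [← heq] at he'
  obtain ⟨s, hs, b, hb, rfl⟩ := Submodule.mem_sup.1 he'
  obtain ⟨a, rfl⟩ := Submodule.mem_span_singleton.1 hb
  have hsS : ∀ x ∈ S, lorentz s x = 0 := fun x hx => by
    have := heS' x hx
    rwa [lorentz_add_left, lorentz_smul_left, heS x hx, mul_zero, add_zero] at this
  obtain ⟨y, hy, hyy⟩ := hS
  -- The component `s` lies in the span of `S` and is orthogonal to it, so it is null; being
  -- orthogonal to a time-like vector, it would otherwise be space-like.
  have hs0 : s = 0 := by
    by_contra hne
    have := lorentz_self_pos_of_orthogonal hyy (hsS y hy) hne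
    rw [lorentz_eq_zero_of_mem_span hsS hs] at this
    exact lt_irrefl _ this
  subst hs0
  simp only [zero_add, lorentz_smul_left, lorentz_smul_right, he1, mul_one] at he1' ⊢
  rcases mul_self_eq_one_iff.1 he1' with rfl | rfl
  · left; simp
  · right; simp

/-! ### Sides of a polytope and their outward normals. -/

theorem IsPolytope.subset_hyperboloid (hC : IsPolytope C) : C ⊆ hyperboloid n := by
  obtain ⟨N, -, rfl⟩ := hC.polyhedron
  exact fun x hx => hx.1

theorem IsPolytope.subset_futureCone (hC : IsPolytope C) : C ⊆ futureCone n :=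
  hC.subset_hyperboloid.trans hyperboloid_subset_futureCone

theorem IsPolytope.nonempty (hC : IsPolytope C) : C.Nonempty := by
  by_contra h
  have := hC.fullDim
  rw [Set.not_nonempty_iff_eq_empty.1 h, Submodule.span_empty] at this
  exact bot_ne_top this

theorem IsPolytope.finrank_span (hC : IsPolytope C) :
    Module.finrank ℝ (Submodule.span ℝ C) = n + 1 := by
  rw [hC.fullDim, finrank_top, Module.finrank_fin_fun]

theorem IsPolytope.hdim_eq (hC : IsPolytope C) : hdim C = n := by
  rw [hdim, hC.finrank_span, Nat.add_sub_cancel]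

theorem finrank_span_pos {S : Set (Mink n)} (hS : S ⊆ hyperboloid n) (hne : S.Nonempty) :
    0 < Module.finrank ℝ (Submodule.span ℝ S) := by
  obtain ⟨y, hy⟩ := hne
  refine Module.finrank_pos_iff_exists_ne_zero.2 ⟨⟨y, Submodule.subset_span hy⟩, fun h => ?_⟩
  exact futureCone_nonzero (hyperboloid_subset_futureCone (hS hy)) (congrArg Subtype.val h)

theorem IsFace.subset {F : Set (Mink n)} (hF : IsFace C F) : F ⊆ C := by
  obtain ⟨-, u, -, rfl⟩ := hF
  exact fun x hx => hx.1

theorem finrank_span_of_isFacet {P S : Set (Mink n)} (hP : P ⊆ hyperboloid n)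
    (hS : IsFacet P S) :
    Module.finrank ℝ (Submodule.span ℝ S) + 1 = Module.finrank ℝ (Submodule.span ℝ P) := by
  have h1 := finrank_span_pos (hS.1.subset.trans hP) hS.1.1
  have h2 := finrank_span_pos hP (hS.1.1.mono hS.1.subset)
  have := hS.2
  simp only [hdim] at this
  omega

theorem IsPolytope.finrank_span_facet (hC : IsPolytope C) (S : Facet C) :
    Module.finrank ℝ (Submodule.span ℝ S.1) = n := by
  have := finrank_span_of_isFacet hC.subset_hyperboloid S.2
  rw [hC.finrank_span] at this
  omega

/-- The supporting vector `u` is orthogonal to an actual, hence time-like, point of `S`, so it is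
space-like and can be normalised. -/
theorem IsPolytope.exists_outwardNormal (hC : IsPolytope C) {u : Mink n} {S : Set (Mink n)}
    (hne : S.Nonempty) (hu0 : u ≠ 0) (hu : ∀ x ∈ C, lorentz u x ≤ 0)
    (hS : S = {x | x ∈ C ∧ lorentz u x = 0}) :
    ∃ a : ℝ, 0 < a ∧ IsOutwardNormal C S (a • u) := by
  subst hS
  obtain ⟨y, hyC, hy⟩ := hne
  have hpos := lorentz_self_pos_of_orthogonal (hC.subset_futureCone hyC).1 hy hu0
  have hs := Real.sqrt_pos.2 hpos
  refine ⟨(√(lorentz u u))⁻¹, inv_pos.2 hs, by rw [hC.fullDim]; trivial, ?_, fun x hx => ?_,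
    fun x hx => ?_⟩
  · simp only [lorentz_smul_left, lorentz_smul_right]
    have := Real.mul_self_sqrt hpos.le
    field_simp
    nlinarith
  · rw [lorentz_smul_left]
    exact mul_nonpos_of_nonneg_of_nonpos (inv_pos.2 hs).le (hu x hx)
  · rw [lorentz_smul_left, hx.2, mul_zero]

theorem IsPolytope.exists_normal (hC : IsPolytope C) (S : Facet C) :
    ∃ e : Mink n, IsOutwardNormal C S.1 e ∧ ∀ x, x ∈ S.1 ↔ x ∈ C ∧ lorentz e x = 0 := by
  obtain ⟨hne, u, hu, hSu⟩ := S.2.1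
  have hu0 : u ≠ 0 := by
    rintro rfl
    have h : S.1 = C := by rw [hSu]; simp
    have h1 := hC.finrank_span_facet S
    rw [h, hC.finrank_span] at h1
    omega
  obtain ⟨a, ha, hau⟩ := hC.exists_outwardNormal hne hu0 hu hSu
  refine ⟨a • u, hau, fun x => ?_⟩
  rw [hSu, lorentz_smul_left, mul_eq_zero_iff_left ha.ne']
  rfl

/-- The outward unit normal vector of a polytope along a side. -/
noncomputable def IsPolytope.normal (hC : IsPolytope C) (S : Facet C) : Mink n :=
  (hC.exists_normal S).choose

theorem IsPolytope.isOutwardNormal_normal (hC : IsPolytope C) (S : Facet C) :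
    IsOutwardNormal C S.1 (hC.normal S) := (hC.exists_normal S).choose_spec.1

theorem IsPolytope.mem_facet_iff (hC : IsPolytope C) (S : Facet C) (x : Mink n) :
    x ∈ S.1 ↔ x ∈ C ∧ lorentz (hC.normal S) x = 0 := (hC.exists_normal S).choose_spec.2 x

theorem IsPolytope.normal_self (hC : IsPolytope C) (S : Facet C) :
    lorentz (hC.normal S) (hC.normal S) = 1 := (hC.isOutwardNormal_normal S).2.1

theorem IsPolytope.normal_nonpos (hC : IsPolytope C) (S : Facet C) {x : Mink n} (hx : x ∈ C) :
    lorentz (hC.normal S) x ≤ 0 := (hC.isOutwardNormal_normal S).2.2.1 x hx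

theorem IsPolytope.normal_ne_zero (hC : IsPolytope C) (S : Facet C) : hC.normal S ≠ 0 := by
  intro h
  have := hC.normal_self S
  rw [h, lorentz_zero_left] at this
  exact zero_ne_one this

theorem IsPolytope.exists_normal_neg (hC : IsPolytope C) (S : Facet C) :
    ∃ x ∈ C, lorentz (hC.normal S) x < 0 := by
  by_contra! h
  refine hC.normal_ne_zero S (eq_zero_of_forall_lorentz fun x => ?_)
  refine lorentz_eq_zero_of_mem_span (S := C)
    (fun x hx => le_antisymm (hC.normal_nonpos S hx) (h x hx)) ?_
  rw [hC.fullDim]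
  trivial

theorem Facet.subset (S : Facet C) : S.1 ⊆ C := S.2.1.subset

theorem IsPolytope.exists_mem_facet_timelike (hC : IsPolytope C) (S : Facet C) :
    ∃ y ∈ S.1, lorentz y y < 0 := by
  obtain ⟨y, hy⟩ := S.2.1.1
  exact ⟨y, hy, (hC.subset_futureCone (S.subset hy)).1⟩

theorem IsPolytope.eq_normal_or_eq_neg (hC : IsPolytope C) (S : Facet C) {e : Mink n}
    (he1 : lorentz e e = 1) (heS : ∀ x ∈ S.1, lorentz e x = 0) :
    e = hC.normal S ∨ e = -hC.normal S :=
  unit_normal_eq_or_eq_neg (W := ⊤) (Set.subset_univ _) (hC.exists_mem_facet_timelike S)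
    (by rw [hC.finrank_span_facet, finrank_top, Module.finrank_fin_fun]) Submodule.mem_top
    (hC.normal_self S) (hC.isOutwardNormal_normal S).2.2.2 Submodule.mem_top he1 heS

/-- The sign is fixed because `C` spans and so has a point strictly inside the half-space. This
turns the existential normals in `HasDihedralAngle` into the chosen ones. -/
theorem IsPolytope.eq_normal (hC : IsPolytope C) (S : Facet C) {e : Mink n}
    (he : IsOutwardNormal C S.1 e) : e = hC.normal S := by
  refine (hC.eq_normal_or_eq_neg S he.2.1 he.2.2.2).resolve_right fun h => ?_
  obtain ⟨x, hx, hneg⟩ := hC.exists_normal_neg S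
  have := he.2.2.1 x hx
  rw [h, lorentz_neg_left] at this
  linarith

/-- Such a normal of `T` is also an outward normal of `S`, so the two chosen normals coincide, and a
side is recovered from its normal. -/
theorem IsPolytope.facet_eq_of_normal (hC : IsPolytope C) {S T : Facet C}
    (h : ∀ x ∈ S.1, lorentz (hC.normal T) x = 0) : S = T := by
  have h' := hC.eq_normal S (e := hC.normal T)
    ⟨by rw [hC.fullDim]; trivial, hC.normal_self T, fun x hx => hC.normal_nonpos T hx, h⟩
  refine Subtype.ext (Set.ext fun x => ?_)
  change x ∈ S.1 ↔ x ∈ T.1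
  rw [hC.mem_facet_iff, hC.mem_facet_iff, h']

theorem IsPolytope.finrank_span_inter_lt (hC : IsPolytope C) {S T : Facet C} (hST : S ≠ T) :
    Module.finrank ℝ (Submodule.span ℝ (S.1 ∩ T.1)) < n := by
  refine (Submodule.finrank_lt_finrank_of_lt (lt_of_le_of_ne
    (Submodule.span_mono Set.inter_subset_left) fun h => hST ?_)).trans_eq (hC.finrank_span_facet S)
  refine hC.facet_eq_of_normal fun x hx => lorentz_eq_zero_of_mem_span
    (S := S.1 ∩ T.1) (fun y hy => ((hC.mem_facet_iff T y).1 hy.2).2) ?_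
  rw [h]
  exact Submodule.subset_span hx

/-- A polytope is cut out by finitely many of its sides. -/
theorem IsPolytope.exists_finite_facets (hC : IsPolytope C) :
    ∃ I : Set (Facet C), I.Finite ∧
      ∀ x, x ∈ hyperboloid n → (∀ S ∈ I, lorentz (hC.normal S) x ≤ 0) → x ∈ C := by
  obtain ⟨N, hN, hCN⟩ := hC.polyhedron
  have hmem : ∀ x, x ∈ C ↔ x ∈ hyperboloid n ∧ ∀ u ∈ N, lorentz u x ≤ 0 := fun x => by
    rw [hCN]; rfl
  refine ⟨Subtype.val ⁻¹' ((fun u => {x | x ∈ C ∧ lorentz u x = 0}) '' (N : Set (Mink n))),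
    (N.finite_toSet.image _).preimage Subtype.val_injective.injOn, fun x hx hxI => ?_⟩
  refine (hmem x).2 ⟨hx, polyhedron_reduction (E := ⊤) N.finite_toSet
    (fun x => by rw [hmem]; simp) hC.nonempty hC.fullDim (hyperboloid_subset_futureCone hx)
    Submodule.mem_top fun u hu hdim => ?_⟩
  rw [finrank_top, Module.finrank_fin_fun] at hdim
  set S : Set (Mink n) := {x | x ∈ C ∧ lorentz u x = 0} with hS
  by_cases hne : S.Nonempty
  · have hu0 : u ≠ 0 := by
      rintro rfl
      simpa using hN 0 hu
    have huC : ∀ x ∈ C, lorentz u x ≤ 0 := fun x hx => ((hmem x).1 hx).2 u hu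
    -- Together with `hdim` this pins the dimension of the span to exactly `n`, so the slice is a
    -- side.
    have hlt : Module.finrank ℝ (Submodule.span ℝ S) < n + 1 := by
      refine (Submodule.finrank_lt_finrank_of_lt (t := ⊤)
        (lt_top_iff_ne_top.2 fun h => hu0 ?_)).trans_eq
        (by rw [finrank_top, Module.finrank_fin_fun])
      refine eq_zero_of_forall_lorentz fun x =>
        lorentz_eq_zero_of_mem_span (S := S) (fun x hx => hx.2) ?_
      rw [h]
      trivial
    have hf : IsFacet C S := by
      refine ⟨⟨hne, u, huC, hS⟩, ?_⟩
      have := finrank_span_pos (fun x hx => hC.subset_hyperboloid hx.1) hne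
      rw [hC.hdim_eq, HypPoly.hdim]
      omega
    obtain ⟨a, ha, hau⟩ := hC.exists_outwardNormal hne hu0 huC hS
    have h := hxI ⟨S, hf⟩ ⟨u, hu, hS.symm⟩
    rw [← hC.eq_normal ⟨S, hf⟩ hau, lorentz_smul_left] at h
    exact nonpos_of_mul_nonpos_right h ha
  -- An empty slice passes the dimension test only for `n = 0`, where no vector is space-like.
  · rw [Set.not_nonempty_iff_eq_empty.1 hne, Submodule.span_empty, finrank_bot] at hdim
    obtain rfl : n = 0 := by omega
    by_contra! hpos
    have hsp := lorentz_self_pos_of_orthogonal (hC.subset_futureCone hC.nonempty.some_mem).1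
      (u := 0) (by simp)
    have := hN u hu
    simp [lorentz] at this
    nlinarith [sq_nonneg (u 0)]

/-! ### Right angles: normals are orthogonal or their hyperplanes do not cross. -/

/-- The half-spaces of the sides adjacent to a side `T` cut out `T` in its hyperplane. -/
theorem IsPolytope.normal_nonpos_of_adjacent (hC : IsPolytope C) (hn : 2 ≤ n) (T : Facet C)
    {z : Mink n} (hz : z ∈ futureCone n) (hzT : lorentz (hC.normal T) z = 0)
    (hadj : ∀ R : Facet C, Adjacent C T.1 R.1 → lorentz (hC.normal R) z ≤ 0) :
    ∃ t : ℝ, 0 < t ∧ t • z ∈ T.1 := by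
  obtain ⟨I, hI, hIC⟩ := hC.exists_finite_facets
  have hspan : Submodule.span ℝ T.1 = LinearMap.ker (lorentzFunctional (hC.normal T)) := by
    refine Submodule.eq_of_le_of_finrank_le
      (Submodule.span_le.2 fun x hx => ((hC.mem_facet_iff T x).1 hx).2) ?_
    have h0 : lorentzFunctional (hC.normal T) ≠ 0 := fun h =>
      hC.normal_ne_zero T (eq_zero_of_forall_lorentz fun x => DFunLike.congr_fun h x)
    have := Module.Dual.finrank_ker_add_one_of_ne_zero h0
    rw [Module.finrank_fin_fun] at this
    rw [hC.finrank_span_facet]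
    omega
  have hred := polyhedron_reduction (N := hC.normal '' I) (P := T.1) (hI.image _)
    (fun x => by
      rw [hC.mem_facet_iff]
      constructor
      · rintro ⟨hx, hxT⟩
        refine ⟨hC.subset_hyperboloid hx, hxT, ?_⟩
        rintro _ ⟨S, -, rfl⟩
        exact hC.normal_nonpos S hx
      · rintro ⟨hx, hxT, hxN⟩
        exact ⟨hIC x hx fun S hS => hxN _ ⟨S, hS, rfl⟩, hxT⟩)
    T.2.1.1 hspan hz hzT (by
      rintro _ ⟨R, hR, rfl⟩ hdim
      by_cases hRT : T = R
      · rw [← hRT, hzT]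
      · refine hadj R ⟨fun h => hRT (Subtype.ext h), ?_⟩
        have hset : {x | x ∈ T.1 ∧ lorentz (hC.normal R) x = 0} = T.1 ∩ R.1 := by
          ext x
          simp only [Set.mem_ofPred_eq, Set.mem_inter_iff, hC.mem_facet_iff R]
          exact ⟨fun h => ⟨h.1, T.subset h.1, h.2⟩, fun h => ⟨h.1, h.2.2⟩⟩
        rw [hset, ← hspan, hC.finrank_span_facet] at hdim
        -- An empty intersection would give `n ≤ 1`; this is where `2 ≤ n` enters.
        have hne : (T.1 ∩ R.1).Nonempty := by
          by_contra hne
          rw [Set.not_nonempty_iff_eq_empty.1 hne, Submodule.span_empty, finrank_bot] at hdim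
          omega
        have hlt := hC.finrank_span_inter_lt hRT
        have hpos := finrank_span_pos
          (fun x hx => hC.subset_hyperboloid (T.subset hx.1)) hne
        refine ⟨hne, ?_⟩
        rw [hC.hdim_eq, HypPoly.hdim]
        omega)
  obtain ⟨t, ht, htz⟩ := exists_smul_mem_hyperboloid hz
  refine ⟨t, ht, (hC.mem_facet_iff T _).2 ⟨hIC _ htz fun S hS => ?_, ?_⟩⟩
  · rw [lorentz_smul_right]
    exact mul_nonpos_of_nonneg_of_nonpos ht.le (hred _ ⟨S, hS, rfl⟩)
  · rw [lorentz_smul_right, hzT, mul_zero]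

theorem IsPolytope.normal_orthogonal_of_adjacent (hC : IsPolytope C) (hR : IsRightAngled C)
    {S T : Facet C} (h : Adjacent C S.1 T.1) : lorentz (hC.normal S) (hC.normal T) = 0 := by
  obtain ⟨e, f, he, hf, hθ⟩ := hR S.1 T.1 S.2 T.2 h
  rw [← hC.eq_normal S he, ← hC.eq_normal T hf]
  have := Real.arccos_eq_pi_div_two.1 hθ.symm
  linarith

/-- The outward normals of distinct sides of a right-angled polytope have non-positive product. -/
theorem IsPolytope.normal_lorentz_nonpos (hC : IsPolytope C) (hn : 2 ≤ n) (hR : IsRightAngled C)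
    {S T : Facet C} (hST : S ≠ T) : lorentz (hC.normal S) (hC.normal T) ≤ 0 := by
  obtain ⟨x, hxS, hxT⟩ : ∃ x ∈ S.1, lorentz (hC.normal T) x < 0 := by
    by_contra! h
    exact hST (hC.facet_eq_of_normal fun x hx =>
      le_antisymm (hC.normal_nonpos T (S.subset hx)) (h x hx))
  have hxF := hC.subset_futureCone (S.subset hxS)
  set b := lorentz (hC.normal T) x with hb
  have hT1 := hC.normal_self T
  have hxT' : lorentz x (hC.normal T) = b := lorentz_comm _ _
  -- This is the orthogonal projection of `x ∈ S` to the hyperplane of `T`. It keeps the pairings of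
  -- `x` with the normals of sides adjacent to `T`, so it lands in `T` up to scaling; the inequality
  -- of `S` there gives the sign.
  have hzF : x - b • hC.normal T ∈ futureCone n := by
    refine mem_futureCone_of_lorentz_neg hxF ?_ ?_ <;>
    simp only [lorentz_sub_left, lorentz_sub_right, lorentz_smul_left, lorentz_smul_right, hT1,
      hxT', ← hb] <;>
    nlinarith [hxF.1, sq_nonneg b]
  obtain ⟨t, ht, htz⟩ := hC.normal_nonpos_of_adjacent hn T hzF (by
    rw [lorentz_sub_right, lorentz_smul_right, hT1, ← hb]; ring) fun R hadj => by
      rw [lorentz_sub_right, lorentz_smul_right, lorentz_comm _ (hC.normal T),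
        hC.normal_orthogonal_of_adjacent hR hadj, mul_zero, sub_zero]
      exact hC.normal_nonpos R (S.subset hxS)
  have h := hC.normal_nonpos S (T.subset htz)
  rw [lorentz_smul_right, lorentz_sub_right, ((hC.mem_facet_iff S x).1 hxS).2,
    lorentz_smul_right] at h
  have h1 := nonpos_of_mul_nonpos_right h ht
  nlinarith

/-- Sides whose hyperplanes cross are adjacent. -/
theorem IsPolytope.adjacent_of_lorentz_normal (hC : IsPolytope C) (hn : 2 ≤ n)
    (hR : IsRightAngled C) {S T : Facet C} (hST : S ≠ T)
    (hc : -1 < lorentz (hC.normal S) (hC.normal T)) : Adjacent C S.1 T.1 := by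
  by_contra hadj
  have hc0 := hC.normal_lorentz_nonpos hn hR hST
  set c := lorentz (hC.normal S) (hC.normal T) with hcdef
  have hc' : lorentz (hC.normal T) (hC.normal S) = c := lorentz_comm _ _
  have hD : 0 < 1 - c ^ 2 := by nlinarith
  have hS1 := hC.normal_self S
  have hT1 := hC.normal_self T
  -- The part of the normal of `S` tangent to the hyperplane of `T`. Subtracting multiples of `v`
  -- projects points of `T` to the intersection of both hyperplanes.
  set v := hC.normal S - c • hC.normal T with hv
  have hvT : lorentz (hC.normal T) v = 0 := by
    rw [hv, lorentz_sub_right, lorentz_smul_right, hT1, hc']; ring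
  have hvS : lorentz (hC.normal S) v = 1 - c ^ 2 := by
    rw [hv, lorentz_sub_right, lorentz_smul_right, hS1, ← hcdef]; ring
  have hvv : lorentz v v = 1 - c ^ 2 := by
    conv_lhs => rw [hv]
    rw [lorentz_sub_left, lorentz_smul_left, hvS, hvT]; ring
  have hproj : ∀ x ∈ T.1, x - (lorentz (hC.normal S) x / (1 - c ^ 2)) • v ∈
      Submodule.span ℝ (S.1 ∩ T.1) := by
    intro x hxT
    have hxC := T.subset hxT
    have hxF := hC.subset_futureCone hxC
    have hxT0 := ((hC.mem_facet_iff T x).1 hxT).2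
    have hs := hC.normal_nonpos S hxC
    set s := lorentz (hC.normal S) x with hsdef
    set α := s / (1 - c ^ 2) with hα
    have hα0 : α ≤ 0 := div_nonpos_of_nonpos_of_nonneg hs hD.le
    have hαs : α * (1 - c ^ 2) = s := div_mul_cancel₀ _ hD.ne'
    have hvx : lorentz v x = s := by
      rw [hv, lorentz_sub_left, lorentz_smul_left, hxT0, ← hsdef]; ring
    have hxv : lorentz x v = s := by rw [lorentz_comm, hvx]
    have hss : 0 ≤ α * s := mul_nonneg_of_nonpos_of_nonpos hα0 hs
    have hzF : x - α • v ∈ futureCone n := by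
      refine mem_futureCone_of_lorentz_neg hxF ?_ ?_ <;>
      simp only [lorentz_sub_left, lorentz_sub_right, lorentz_smul_left, lorentz_smul_right, hvv,
        hxv, hvx, hαs] <;>
      linarith [hxF.1]
    have hzT : lorentz (hC.normal T) (x - α • v) = 0 := by
      rw [lorentz_sub_right, lorentz_smul_right, hvT, hxT0]; ring
    have hzS : lorentz (hC.normal S) (x - α • v) = 0 := by
      rw [lorentz_sub_right, lorentz_smul_right, hvS, ← hsdef, hαs, sub_self]
    -- A side `R` adjacent to `T` is not `S`, by the assumption `hadj`. It is orthogonal to `T` and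
    -- pairs non-positively with `S`, so with `α ≤ 0` the projection still satisfies its inequality.
    obtain ⟨t, ht, htz⟩ := hC.normal_nonpos_of_adjacent hn T hzF hzT fun R hTR => by
      have hRS : R ≠ S := by
        rintro rfl
        refine hadj ⟨hTR.1.symm, ?_⟩
        rw [Set.inter_comm]
        exact hTR.2
      have h1 := hC.normal_lorentz_nonpos hn hR hRS
      have h2 := hC.normal_orthogonal_of_adjacent hR hTR
      rw [lorentz_comm] at h2
      rw [lorentz_sub_right, lorentz_smul_right, hv, lorentz_sub_right, lorentz_smul_right, h2]
      have := hC.normal_nonpos R hxC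
      nlinarith [mul_nonneg_of_nonpos_of_nonpos hα0 h1]
    refine (Submodule.smul_mem_iff _ ht.ne').1 (Submodule.subset_span ⟨?_, htz⟩)
    exact (hC.mem_facet_iff S _).2 ⟨T.subset htz, by
      rw [lorentz_smul_right, hzS, mul_zero]⟩
  -- Otherwise the projection of a point of `T` is `0`, making that time-like point a multiple of
  -- the space-like `v`.
  have hTS : ∃ x, x ∈ S.1 ∩ T.1 := by
    by_contra! hemp
    obtain ⟨x, hx⟩ := T.2.1.1
    have h := hproj x hx
    rw [Set.eq_empty_iff_forall_notMem.2 hemp, Submodule.span_empty, Submodule.mem_bot] at h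
    have hxC := T.subset hx
    have hxF := hC.subset_futureCone hxC
    have h2 : x = (lorentz (hC.normal S) x / (1 - c ^ 2)) • v := sub_eq_zero.1 h
    have h3 := hxF.1
    rw [h2, lorentz_smul_left, lorentz_smul_right, hvv] at h3
    nlinarith [mul_self_nonneg (lorentz (hC.normal S) x / (1 - c ^ 2))]
  refine hadj ⟨fun h => hST (Subtype.ext h), hTS, ?_⟩
  -- The span of `S ∩ T` loses at most the direction `v` from that of `T`, so the intersection has
  -- codimension two, against `hadj`.
  have hle : Submodule.span ℝ T.1 ≤ Submodule.span ℝ (S.1 ∩ T.1) ⊔ Submodule.span ℝ {v} := by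
    refine Submodule.span_le.2 fun x hx => ?_
    have := Submodule.add_mem_sup (hproj x hx) (Submodule.smul_mem _
      (lorentz (hC.normal S) x / (1 - c ^ 2)) (Submodule.mem_span_singleton_self v))
    rwa [sub_add_cancel] at this
  have h1 := Submodule.finrank_mono hle
  have h2 := Submodule.finrank_add_le_finrank_add_finrank
    (Submodule.span ℝ (S.1 ∩ T.1)) (Submodule.span ℝ {v})
  have h3 := finrank_span_singleton (K := ℝ) (v := v) (by
    rintro h0
    rw [h0, lorentz_zero_left] at hvv
    linarith)
  have hlt := hC.finrank_span_inter_lt hST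
  rw [hC.finrank_span_facet] at h1
  rw [hC.hdim_eq, HypPoly.hdim]
  omega

/-! ### Reflections as isometries. -/

/-- The linear reflection in the hyperplane orthogonal to the unit vector `e`. -/
def reflect (e x : Mink n) : Mink n := x - (2 * lorentz e x) • e

theorem lorentz_reflect_right (f e x : Mink n) :
    lorentz f (reflect e x) = lorentz f x - 2 * lorentz e x * lorentz f e := by
  rw [reflect, lorentz_sub_right, lorentz_smul_right]

theorem lorentz_reflect_reflect {e : Mink n} (he : lorentz e e = 1) (x y : Mink n) :
    lorentz (reflect e x) (reflect e y) = lorentz x y := by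
  simp only [reflect, lorentz_sub_right, lorentz_smul_right, lorentz_sub_left, lorentz_smul_left,
    he, lorentz_comm x e]
  ring

theorem reflect_reflect {e : Mink n} (he : lorentz e e = 1) (x : Mink n) :
    reflect e (reflect e x) = x := by
  have h : lorentz e (reflect e x) = -lorentz e x := by
    rw [lorentz_reflect_right, he]; ring
  rw [reflect, h, reflect]
  module

theorem reflect_comm {e f : Mink n} (hef : lorentz e f = 0) (x : Mink n) :
    reflect e (reflect f x) = reflect f (reflect e x) := by
  have h1 : lorentz e (reflect f x) = lorentz e x := by
    rw [lorentz_reflect_right, hef]; ring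
  have h2 : lorentz f (reflect e x) = lorentz f x := by
    rw [lorentz_reflect_right, lorentz_comm f e, hef]; ring
  rw [reflect, h1, reflect, reflect.eq_1 f (reflect e x), h2, reflect]
  module

theorem reflect_neg (e x : Mink n) : reflect (-e) x = reflect e x := by
  simp only [reflect, lorentz_neg_left]
  module

theorem reflect_mem_hyperboloid {e x : Mink n} (he : lorentz e e = 1) (hx : x ∈ hyperboloid n) :
    reflect e x ∈ hyperboloid n := by
  have h : lorentz (reflect e x) (reflect e x) = -1 := by
    rw [lorentz_reflect_reflect he, hx.1]
  refine ⟨h, (mem_futureCone_of_lorentz_neg (hyperboloid_subset_futureCone hx)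
    (by rw [h]; norm_num) ?_).2⟩
  rw [lorentz_reflect_right, hx.1, lorentz_comm x e]
  nlinarith [mul_self_nonneg (lorentz e x)]

/-- The reflection of `hypSubspace W` in the hyperplane orthogonal to the unit vector `e`. -/
def reflIsom (W : Submodule ℝ (Mink n)) (e : Mink n) (heW : e ∈ W) (he : lorentz e e = 1) :
    Isom (hypSubspace W) :=
  ⟨Function.Involutive.toPerm
    (fun x : hypSubspace W => (⟨reflect e x, reflect_mem_hyperboloid he x.2.1,
      W.sub_mem x.2.2 (W.smul_mem _ heW)⟩ : hypSubspace W))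
    (fun x => Subtype.ext (reflect_reflect he x)),
    fun x y => by
      change hdist (reflect e x) (reflect e y) = hdist (x : Mink n) y
      rw [hdist, hdist, lorentz_reflect_reflect he]⟩

theorem reflIsom_apply {W : Submodule ℝ (Mink n)} {e : Mink n} (heW : e ∈ W)
    (he : lorentz e e = 1) (x : hypSubspace W) :
    ((reflIsom W e heW he).1 x : Mink n) = reflect e x := rfl

theorem isom_ext {X : Set (Mink n)} {g h : Isom X} (H : ∀ x, (g.1 x : Mink n) = h.1 x) : g = h :=
  Subtype.ext (Equiv.ext fun x => Subtype.ext (H x))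

theorem reflIsom_mul_self {W : Submodule ℝ (Mink n)} {e : Mink n} (heW : e ∈ W)
    (he : lorentz e e = 1) : reflIsom W e heW he * reflIsom W e heW he = 1 :=
  isom_ext fun x => reflect_reflect he x

theorem reflIsom_mul_comm {W : Submodule ℝ (Mink n)} {e f : Mink n} (heW : e ∈ W)
    (he : lorentz e e = 1) (hfW : f ∈ W) (hf : lorentz f f = 1) (hef : lorentz e f = 0) :
    reflIsom W e heW he * reflIsom W f hfW hf = reflIsom W f hfW hf * reflIsom W e heW he :=
  isom_ext fun x => reflect_comm hef x

/-- There is only one reflection in a given hyperplane. -/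
theorem isReflectionIn_iff {W : Submodule ℝ (Mink n)} {S : Set (Mink n)}
    (hSW : S ⊆ W) (hS : ∃ y ∈ S, lorentz y y < 0)
    (hdim : Module.finrank ℝ (Submodule.span ℝ S) + 1 = Module.finrank ℝ W)
    {e : Mink n} (heW : e ∈ W) (he : lorentz e e = 1) (heS : ∀ x ∈ S, lorentz e x = 0)
    {g : Isom (hypSubspace W)} : IsReflectionIn W S g ↔ g = reflIsom W e heW he := by
  constructor
  · rintro ⟨f, hfW, hf, hfS, hg⟩
    refine isom_ext fun x => (hg x).trans ?_
    rw [reflIsom_apply]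
    rcases unit_normal_eq_or_eq_neg hSW hS hdim heW he heS hfW hf hfS with rfl | rfl
    · rfl
    · exact reflect_neg _ _
  · rintro rfl
    exact ⟨e, heW, he, heS, fun x => rfl⟩

/-- Half-spaces with opposite, non-crossing boundaries are disjoint. -/
theorem lorentz_neg_of_disjoint {e f x y : Mink n} (he : lorentz e e = 1) (hf : lorentz f f = 1)
    (hef : lorentz e f ≤ -1) (hx : x ∈ futureCone n) (hex : lorentz e x < 0)
    (hfx : lorentz f x < 0) (hy : y ∈ futureCone n) (hfy : 0 < lorentz f y) :
    lorentz e y < 0 := by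
  -- The sum `e + f` is causal, so it has a constant sign on the future cone, and `x` shows that it
  -- is negative.
  have hu : lorentz (e + f) (e + f) ≤ 0 := by
    simp only [lorentz_add_left, lorentz_add_right, he, hf, lorentz_comm f e]
    linarith
  have hux : lorentz (e + f) x < 0 := by
    rw [lorentz_add_left]; linarith
  have hu0 : e + f ≠ 0 := by
    intro h
    rw [h, lorentz_zero_left] at hux
    exact lt_irrefl _ hux
  rcases causal_sign hu0 hu with h | h
  · have := h y hy
    rw [lorentz_add_left] at this
    linarith
  · exact absurd (h x hx) (not_lt.2 hux.le)

/-! ### Right-angled Coxeter groups and ping-pong. -/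

section Coxeter

variable {B : Type*}

theorem isLiftable_of_rightAngled {M : CoxeterMatrix B} {G : Type*} [Group G] {f : B → G}
    (hsq : ∀ s, f s * f s = 1)
    (hcomm : ∀ s t, s ≠ t → M s t = 0 ∨ (M s t = 2 ∧ f s * f t = f t * f s)) :
    M.IsLiftable f := by
  intro s t
  by_cases hst : s = t
  · rw [hst, M.diagonal, pow_one, hsq]
  · rcases hcomm s t hst with h | ⟨h, hc⟩
    · rw [h, pow_zero]
    · rw [h, sq, mul_assoc, ← mul_assoc (f t), ← hc, mul_assoc, hsq, mul_one, hsq]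

theorem simple_mul_comm {W : Type*} [Group W] {M : CoxeterMatrix B} (cs : CoxeterSystem M W)
    {s t : B} (h : M s t = 2) : cs.simple s * cs.simple t = cs.simple t * cs.simple s := by
  have h2 := cs.simple_mul_simple_pow s t
  rw [h, sq] at h2
  have h3 := eq_inv_of_mul_eq_one_left h2
  rwa [mul_inv_rev, cs.inv_simple, cs.inv_simple] at h3

/-- The restriction of a Coxeter matrix to a subset of the generators. -/
def restrictMatrix (M : CoxeterMatrix B) (A : Set B) : CoxeterMatrix A where
  M := M.M.submatrix Subtype.val Subtype.val
  isSymm := M.isSymm.submatrix _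
  diagonal s := M.diagonal s
  off_diagonal s t h := M.off_diagonal s t fun h' => h (Subtype.ext h')

/-- A system of unit normal vectors in `W` whose hyperplanes, according to the Coxeter matrix `M`,
are orthogonal or do not cross. -/
structure IsRightAngledSystem (M : CoxeterMatrix B) (W : Submodule ℝ (Mink n))
    (e : B → Mink n) : Prop where
  mem : ∀ s, e s ∈ W
  unit : ∀ s, lorentz (e s) (e s) = 1
  rel : ∀ s t, s ≠ t →
    (M s t = 0 ∧ lorentz (e s) (e t) ≤ -1) ∨ (M s t = 2 ∧ lorentz (e s) (e t) = 0)

/-- Ping-pong: the orbit of a point of the chamber lies on the negative side of the hyperplane of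
each generator that is not a left descent. -/
theorem lorentz_neg_of_not_isLeftDescent {W : Type*} [Group W] {M : CoxeterMatrix B}
    (cs : CoxeterSystem M W) {E : Submodule ℝ (Mink n)} {e : B → Mink n}
    (he : IsRightAngledSystem M E e) {p : W → Mink n} (hp : ∀ w, p w ∈ futureCone n)
    (hps : ∀ s w, p (cs.simple s * w) = reflect (e s) (p w))
    (h1 : ∀ s, lorentz (e s) (p 1) < 0) (w : W) :
    ∀ s, ¬ cs.IsLeftDescent w s → lorentz (e s) (p w) < 0 := by
  induction hk : cs.length w using Nat.strong_induction_on generalizing w with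
  | _ k ih =>
  intro s hs
  by_cases hw : w = 1
  · rw [hw]; exact h1 s
  obtain ⟨t, ht⟩ := cs.exists_leftDescent_of_ne_one hw
  have hst : s ≠ t := by
    rintro rfl
    exact hs ht
  -- Strip off a left descent `t` of `w`: by induction the orbit point of `v` is on the negative
  -- side of `t`, so that of `w` is on the positive side.
  set v := cs.simple t * w with hv
  have hwv : w = cs.simple t * v := (cs.simple_mul_simple_cancel_left t).symm
  have hlt : cs.length v < k := hk ▸ ht
  have hvt := ih _ hlt v rfl t (cs.isLeftDescent_iff_not_isLeftDescent_mul.1 ht)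
  have hpos : 0 < lorentz (e t) (p w) := by
    rw [hwv, hps, lorentz_reflect_right, he.unit]
    linarith
  rcases he.rel s t hst with ⟨-, hc⟩ | ⟨hM, hc⟩
  · exact lorentz_neg_of_disjoint (he.unit s) (he.unit t) hc (hp 1) (h1 s) (h1 t) (hp w) hpos
  -- In the commuting case, if `s` shortened `v` it would also shorten `w = tv`, as `sw = t(sv)`. So
  -- induction applies to `v`, and reflecting in `t` does not change the pairing with `e s`.
  · have hvs : ¬ cs.IsLeftDescent v s := by
      intro hvs
      have hcomm : cs.simple s * w = cs.simple t * (cs.simple s * v) := by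
        refine (congrArg (cs.simple s * ·) hwv).trans ?_
        rw [← mul_assoc, simple_mul_comm cs hM, mul_assoc]
      have a1 := cs.length_simple_mul (cs.simple s * v) t
      rw [← hcomm] at a1
      have a2 := cs.isLeftDescent_iff.1 hvs
      have a3 := cs.not_isLeftDescent_iff.1 hs
      have a4 := cs.isLeftDescent_iff.1 ht
      rw [← hv] at a4
      omega
    rw [hwv, hps, lorentz_reflect_right, hc, mul_zero, sub_zero]
    exact ih _ hlt v rfl s hvs

namespace IsRightAngledSystem

variable {M : CoxeterMatrix B} {E : Submodule ℝ (Mink n)} {e : B → Mink n}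

theorem isLiftable (he : IsRightAngledSystem M E e) :
    M.IsLiftable fun s => reflIsom E (e s) (he.mem s) (he.unit s) :=
  isLiftable_of_rightAngled (fun _ => reflIsom_mul_self _ _) fun s t hst =>
    (he.rel s t hst).imp And.left (And.imp_right (reflIsom_mul_comm _ _ _ _))

/-- The action of the right-angled Coxeter group by reflections. -/
noncomputable def toIsom (he : IsRightAngledSystem M E e) : M.Group →* Isom (hypSubspace E) :=
  M.toCoxeterSystem.lift ⟨_, he.isLiftable⟩

theorem toIsom_simple (he : IsRightAngledSystem M E e) (s : B) :
    he.toIsom (M.simple s) = reflIsom E (e s) (he.mem s) (he.unit s) :=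
  M.toCoxeterSystem.lift_apply_simple he.isLiftable s

/-- If `w ≠ 1` acted trivially, take a left descent `t`. Ping-pong for `tw` puts the image of `x`
under `t` on the negative side of `t`, whereas the reflection moves it to the positive side. -/
theorem toIsom_injective (he : IsRightAngledSystem M E e) {x : Mink n} (hxH : x ∈ hyperboloid n)
    (hxE : x ∈ E) (hx : ∀ s, lorentz (e s) x < 0) : Function.Injective he.toIsom := by
  refine (injective_iff_map_eq_one _).2 fun w hw => ?_
  by_contra hne
  set x₀ : hypSubspace E := ⟨x, hxH, hxE⟩
  have hps : ∀ s w, ((he.toIsom (M.simple s * w)).1 x₀ : Mink n) =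
      reflect (e s) ((he.toIsom w).1 x₀) := fun s w => by
    rw [map_mul, toIsom_simple]
    rfl
  have hneg := lorentz_neg_of_not_isLeftDescent M.toCoxeterSystem he
    (p := fun w => ((he.toIsom w).1 x₀ : Mink n))
    (fun w => hyperboloid_subset_futureCone ((he.toIsom w).1 x₀).2.1) hps
    (fun s => by rw [map_one]; exact hx s)
  obtain ⟨t, ht⟩ := M.toCoxeterSystem.exists_leftDescent_of_ne_one hne
  have h := hneg _ t (M.toCoxeterSystem.isLeftDescent_iff_not_isLeftDescent_mul.1 ht)
  rw [CoxeterMatrix.toCoxeterSystem_simple] at h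
  simp only [hps] at h
  rw [hw, lorentz_reflect_right, he.unit] at h
  have := hx t
  change lorentz (e t) x - 2 * lorentz (e t) x * 1 < 0 at h
  linarith

theorem exists_mulEquiv (he : IsRightAngledSystem M E e)
    (hinj : Function.Injective he.toIsom) {H : Subgroup (Isom (hypSubspace E))}
    (hH : he.toIsom.range = H) :
    ∃ φ : M.Group ≃* H, ∀ w, (φ w : Isom (hypSubspace E)) = he.toIsom w :=
  ⟨(MonoidHom.ofInjective hinj).trans (MulEquiv.subgroupCongr hH), fun _ => rfl⟩

theorem range_toIsom (he : IsRightAngledSystem M E e) :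
    he.toIsom.range = Subgroup.closure
      (Set.range fun s => reflIsom E (e s) (he.mem s) (he.unit s)) := by
  rw [MonoidHom.range_eq_map, ← M.toCoxeterSystem.subgroup_closure_range_simple,
    MonoidHom.map_closure, ← Set.range_comp]
  congr 2

end IsRightAngledSystem

/-! ### Retractions obtained by deleting generators. -/

variable {M : CoxeterMatrix B} {W : Type*} [Group W] (cs : CoxeterSystem M W)

/-- A right-angled Coxeter group retracts onto its special subgroups. -/
theorem exists_special_retraction (hM : ∀ s t, s ≠ t → M s t = 0 ∨ M s t = 2) {A : Set B}
    {H : Subgroup W} (hH : H = Subgroup.closure (cs.simple '' A)) :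
    ∃ ρ : W →* H, (∀ g : H, ρ g = g) ∧ ∀ s ∉ A, ρ (cs.simple s) = 1 := by
  classical
  subst hH
  set H := Subgroup.closure (cs.simple '' A)
  set f : B → H := fun s =>
    if h : s ∈ A then ⟨cs.simple s, Subgroup.subset_closure ⟨s, h, rfl⟩⟩ else 1 with hf
  have hfA : ∀ s (h : s ∈ A), f s = ⟨cs.simple s, Subgroup.subset_closure ⟨s, h, rfl⟩⟩ :=
    fun s h => dif_pos h
  have hfA' : ∀ s, s ∉ A → f s = 1 := fun s h => dif_neg h
  have hlift : M.IsLiftable f := by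
    refine isLiftable_of_rightAngled (fun s => ?_) fun s t hst => (hM s t hst).imp_right ?_
    · by_cases hs : s ∈ A
      · rw [hfA s hs]
        exact Subtype.ext (cs.simple_mul_simple_self s)
      · rw [hfA' s hs, one_mul]
    · intro h2
      refine ⟨h2, ?_⟩
      by_cases hs : s ∈ A
      · by_cases ht : t ∈ A
        · rw [hfA s hs, hfA t ht]
          exact Subtype.ext (simple_mul_comm cs h2)
        · rw [hfA' t ht, one_mul, mul_one]
      · rw [hfA' s hs, one_mul, mul_one]
  have hρ : ∀ s, cs.lift ⟨f, hlift⟩ (cs.simple s) = f s := cs.lift_apply_simple hlift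
  refine ⟨cs.lift ⟨f, hlift⟩, fun g => ?_, fun s hs => (hρ s).trans (hfA' s hs)⟩
  obtain ⟨g, hg⟩ := g
  refine Subtype.ext ?_
  have heq : Set.EqOn (H.subtype.comp (cs.lift ⟨f, hlift⟩)) (MonoidHom.id W) (cs.simple '' A) := by
    rintro _ ⟨s, hs, rfl⟩
    simp only [MonoidHom.comp_apply, hρ, hfA s hs, Subgroup.subtype_apply, MonoidHom.id_apply]
  exact MonoidHom.eqOn_closure heq hg

/-- The quotient of a right-angled Coxeter group by the normal closure of a special subgroup is
the complementary special subgroup. -/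
theorem exists_special_quotient (hM : ∀ s t, s ≠ t → M s t = 0 ∨ M s t = 2) {A : Set B}
    {H H' : Subgroup W} (hH : H = Subgroup.closure (cs.simple '' A))
    (hH' : H' = Subgroup.closure (cs.simple '' Aᶜ)) :
    ∃ e : (W ⧸ Subgroup.normalClosure (H' : Set W)) ≃* H,
      ∀ g : H, e (QuotientGroup.mk (g : W)) = g := by
  subst hH hH'
  obtain ⟨ρ, hρA, hρB⟩ := exists_special_retraction cs hM rfl
  set N := Subgroup.normalClosure (Subgroup.closure (cs.simple '' Aᶜ) : Set W) with hN
  have hker : N ≤ ρ.ker := by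
    refine Subgroup.normalClosure_le_normal ?_
    change Subgroup.closure (cs.simple '' Aᶜ) ≤ ρ.ker
    rw [Subgroup.closure_le]
    rintro _ ⟨s, hs, rfl⟩
    exact hρB s hs
  -- The inverse of the map induced by `ρ` is inclusion followed by projection; generators outside
  -- `A` die on both sides.
  have hinv : ((QuotientGroup.mk' N).comp (Subgroup.subtype _)).comp ρ = QuotientGroup.mk' N := by
    refine cs.ext_simple fun s => ?_
    by_cases hs : s ∈ A
    · have := hρA ⟨cs.simple s, Subgroup.subset_closure ⟨s, hs, rfl⟩⟩
      simp only [MonoidHom.comp_apply, this]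
      rfl
    · rw [MonoidHom.comp_apply, hρB s hs, map_one]
      symm
      rw [QuotientGroup.mk'_apply, QuotientGroup.eq_one_iff]
      exact Subgroup.subset_normalClosure (Subgroup.subset_closure ⟨s, hs, rfl⟩)
  refine ⟨MonoidHom.toMulEquiv (QuotientGroup.lift N ρ hker)
    ((QuotientGroup.mk' N).comp (Subgroup.subtype _)) ?_ ?_, fun g => hρA g⟩
  · refine QuotientGroup.monoidHom_ext N ?_
    rw [MonoidHom.id_comp]
    exact hinv
  · exact MonoidHom.ext fun g => hρA g

end Coxeter

/-- The same deletion, now onto an abstract Coxeter group: the reflection group of a face acts on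
another space and is not literally a subgroup of `Γ`. -/
theorem exists_restrict_retraction {B : Type*} {M : CoxeterMatrix B}
    (hM : ∀ s t, s ≠ t → M s t = 0 ∨ M s t = 2) (A : Set B) :
    ∃ (j : (restrictMatrix M A).Group →* M.Group) (r : M.Group →* (restrictMatrix M A).Group),
      (∀ a : A, j ((restrictMatrix M A).simple a) = M.simple a) ∧ ∀ w, r (j w) = w := by
  classical
  set MA := restrictMatrix M A with hMA
  have hj : MA.IsLiftable fun a : A => M.simple a := fun a b =>
    M.toCoxeterSystem.simple_mul_simple_pow a b
  set f : B → MA.Group := fun s => if h : s ∈ A then MA.simple ⟨s, h⟩ else 1 with hf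
  have hfA : ∀ a : A, f a = MA.simple a := fun a => dif_pos a.2
  have hfA' : ∀ s, s ∉ A → f s = 1 := fun s h => dif_neg h
  have hr : M.IsLiftable f := by
    refine isLiftable_of_rightAngled (fun s => ?_) fun s t hst => (hM s t hst).imp_right ?_
    · by_cases hs : s ∈ A
      · rw [hfA ⟨s, hs⟩]
        exact MA.toCoxeterSystem.simple_mul_simple_self _
      · rw [hfA' s hs, one_mul]
    · intro h2
      refine ⟨h2, ?_⟩
      by_cases hs : s ∈ A
      · by_cases ht : t ∈ A
        · rw [hfA ⟨s, hs⟩, hfA ⟨t, ht⟩]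
          exact simple_mul_comm MA.toCoxeterSystem (s := ⟨s, hs⟩) (t := ⟨t, ht⟩) h2
        · rw [hfA' t ht, one_mul, mul_one]
      · rw [hfA' s hs, one_mul, mul_one]
  have hj' := MA.toCoxeterSystem.lift_apply_simple hj
  have hr' := M.toCoxeterSystem.lift_apply_simple hr
  refine ⟨MA.toCoxeterSystem.lift ⟨_, hj⟩, M.toCoxeterSystem.lift ⟨_, hr⟩, hj', fun w => ?_⟩
  have : (M.toCoxeterSystem.lift ⟨_, hr⟩).comp (MA.toCoxeterSystem.lift ⟨_, hj⟩) =
      MonoidHom.id _ := by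
    refine MA.toCoxeterSystem.ext_simple fun a => ?_
    rw [MonoidHom.comp_apply, hj' a]
    exact (hr' a).trans (hfA a)
  exact DFunLike.congr_fun this w

/-! ### Faces: relative interior points, spans and sides. -/

theorem IsPolytope.mem_of_mem_cone (hC : IsPolytope C) {x : Mink n} (hx : x ∈ hyperboloid n)
    (h : ∀ u : Mink n, (∀ y ∈ C, lorentz u y ≤ 0) → lorentz u x ≤ 0) : x ∈ C := by
  obtain ⟨I, -, hI⟩ := hC.exists_finite_facets
  exact hI x hx fun S _ => h _ fun y hy => hC.normal_nonpos S hy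

/-- A relative interior point of an intersection of `C` with a subspace. -/
theorem IsPolytope.exists_relint (hC : IsPolytope C) {F : Set (Mink n)} (hne : F.Nonempty)
    (hFC : F ⊆ C) (hF : ∀ x ∈ C, x ∈ Submodule.span ℝ F → x ∈ F) :
    ∃ x ∈ F, ∀ R : Facet C, ¬ F ⊆ R.1 → lorentz (hC.normal R) x < 0 := by
  -- The point is the normalised sum of a basis taken from `F`. A normal vanishing at the sum of
  -- these non-positive terms vanishes at each, hence on all of `F`.
  obtain ⟨b, hbF, hbspan, hbli⟩ := exists_linearIndependent ℝ F
  have hfin : b.Finite := hbli.setFinite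
  set s := hfin.toFinset with hs
  have hsF : ∀ y ∈ s, y ∈ F := fun y hy => hbF (hfin.mem_toFinset.1 hy)
  have hbne : s.Nonempty := by
    rw [hs, Set.Finite.toFinset_nonempty]
    by_contra h
    obtain ⟨y, hy⟩ := hne
    have hy' : y ∈ Submodule.span ℝ F := Submodule.subset_span hy
    rw [← hbspan, Set.not_nonempty_iff_eq_empty.1 h, Submodule.span_empty,
      Submodule.mem_bot] at hy'
    exact futureCone_nonzero (hC.subset_futureCone (hFC hy)) hy'
  have hsum : ∀ u : Mink n, lorentz u (∑ y ∈ s, y) = ∑ y ∈ s, lorentz u y := fun u =>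
    map_sum (lorentzFunctional u) _ _
  have hxF : ∑ y ∈ s, y ∈ futureCone n :=
    Finset.sum_induction_nonempty _ (· ∈ futureCone n) (fun _ _ => futureCone_add) hbne
      fun y hy => hC.subset_futureCone (hFC (hsF y hy))
  obtain ⟨t, ht, htx⟩ := exists_smul_mem_hyperboloid hxF
  refine ⟨t • ∑ y ∈ s, y, hF _ (hC.mem_of_mem_cone htx fun u hu => ?_) ?_, fun R hR => ?_⟩
  · rw [lorentz_smul_right, hsum]
    exact mul_nonpos_of_nonneg_of_nonpos ht.le
      (Finset.sum_nonpos fun y hy => hu y (hFC (hsF y hy)))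
  · exact Submodule.smul_mem _ _ (Submodule.sum_mem _ fun y hy => Submodule.subset_span (hsF y hy))
  · rw [lorentz_smul_right, hsum]
    refine mul_neg_of_pos_of_neg ht ?_
    have hle : ∀ y ∈ s, lorentz (hC.normal R) y ≤ 0 := fun y hy =>
      hC.normal_nonpos R (hFC (hsF y hy))
    refine lt_of_le_of_ne (Finset.sum_nonpos hle) fun h0 => hR fun y hy => ?_
    refine (hC.mem_facet_iff R y).2 ⟨hFC hy, lorentz_eq_zero_of_mem_span (S := b) (fun z hz => ?_)
      (hbspan ▸ Submodule.subset_span hy)⟩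
    exact (Finset.sum_eq_zero_iff_of_nonpos hle).1 h0 z (hfin.mem_toFinset.2 hz)

/-- A direction pointing into all half-spaces whose boundary contains `x ∈ C` points into `C`. -/
theorem IsPolytope.exists_feasible (hC : IsPolytope C) {x : Mink n} (hx : x ∈ C) {d : Mink n}
    (hd : ∀ S : Facet C, lorentz (hC.normal S) x = 0 → lorentz (hC.normal S) d ≤ 0) :
    ∃ ε t : ℝ, 0 < ε ∧ 0 < t ∧ t • (x + ε • d) ∈ C := by
  obtain ⟨I, hI, hIC⟩ := hC.exists_finite_facets
  obtain ⟨ε, hε, hF, hJ⟩ := exists_perturbation (hC.subset_futureCone hx) d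
    (J := hC.normal '' {S | S ∈ I ∧ lorentz (hC.normal S) x < 0})
    ((hI.subset fun S hS => hS.1).image _) (by rintro _ ⟨S, hS, rfl⟩; exact hS.2)
  obtain ⟨t, ht, htx⟩ := exists_smul_mem_hyperboloid hF
  refine ⟨ε, t, hε, ht, hIC _ htx fun S hS => ?_⟩
  rw [lorentz_smul_right]
  refine mul_nonpos_of_nonneg_of_nonpos ht.le ?_
  rcases (hC.normal_nonpos S hx).lt_or_eq with h | h
  · exact (hJ _ ⟨S, ⟨hS, h⟩, rfl⟩).le
  · rw [lorentz_add_right, h, zero_add, lorentz_smul_right]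
    exact mul_nonpos_of_nonneg_of_nonpos hε.le (hd S h)

theorem IsFace.mem_of_mem_span {F : Set (Mink n)} (hF : IsFace C F) {x : Mink n} (hx : x ∈ C)
    (hxF : x ∈ Submodule.span ℝ F) : x ∈ F := by
  obtain ⟨-, u, -, rfl⟩ := hF
  exact ⟨hx, lorentz_eq_zero_of_mem_span (fun y hy => hy.2) hxF⟩

/-- The span of a face is the intersection of the hyperplanes of the sides containing it. -/
theorem IsPolytope.mem_span_face (hC : IsPolytope C) {F : Set (Mink n)} (hF : IsFace C F)
    {z : Mink n} (hz : ∀ S : Facet C, F ⊆ S.1 → lorentz (hC.normal S) z = 0) :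
    z ∈ Submodule.span ℝ F := by
  obtain ⟨x, hxF, hx⟩ := hC.exists_relint hF.1 hF.subset fun _ => hF.mem_of_mem_span
  -- Sides through the relative interior point `x` contain `F`, so both `z` and `-z` are feasible at
  -- `x`. The functional supporting `F` must then vanish on `z`.
  have hz' : ∀ S : Facet C, lorentz (hC.normal S) x = 0 → lorentz (hC.normal S) z = 0 :=
    fun S hS => hz S (by by_contra h; exact (hx S h).ne hS)
  obtain ⟨ε, t, hε, ht, h⟩ := hC.exists_feasible (hF.subset hxF) fun S hS => (hz' S hS).le
  obtain ⟨ε', t', hε', ht', h'⟩ := hC.exists_feasible (hF.subset hxF) (d := -z)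
    fun S hS => by rw [lorentz_neg_right, hz' S hS, neg_zero]
  have hspan : t • (x + ε • z) ∈ Submodule.span ℝ F := by
    obtain ⟨-, u, hu, rfl⟩ := hF
    refine Submodule.subset_span ⟨h, ?_⟩
    have h1 := hu _ h
    have h2 := hu _ h'
    rw [lorentz_smul_right, lorentz_add_right, lorentz_smul_right, hxF.2, zero_add] at h1 h2
    have h3 := nonpos_of_mul_nonpos_right (nonpos_of_mul_nonpos_right h1 ht) hε
    have h4 := nonpos_of_mul_nonpos_right (nonpos_of_mul_nonpos_right h2 ht') hε'
    rw [lorentz_neg_right] at h4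
    have h5 : lorentz u z = 0 := by linarith
    rw [lorentz_smul_right, lorentz_add_right, lorentz_smul_right, hxF.2, h5, mul_zero, zero_add,
      mul_zero]
  have h1 := (Submodule.smul_mem_iff _ ht.ne').1 hspan
  have h2 := Submodule.sub_mem _ h1 (Submodule.subset_span hxF)
  rw [add_sub_cancel_left] at h2
  exact (Submodule.smul_mem_iff _ hε.ne').1 h2

/-- Every side of a face `F` is the intersection of `F` with a side of the polytope. -/
theorem IsPolytope.exists_facet_inter (hC : IsPolytope C) {F G : Set (Mink n)}
    (hF : IsFace C F) (hG : IsFacet F G) : ∃ T : Facet C, T.1 ∩ F = G := by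
  have hFH := hF.subset.trans hC.subset_hyperboloid
  have hGspan : ∀ x ∈ C, x ∈ Submodule.span ℝ G → x ∈ G := fun x hx hxG =>
    hG.1.mem_of_mem_span (hF.mem_of_mem_span hx (Submodule.span_mono hG.1.subset hxG)) hxG
  have hdim := finrank_span_of_isFacet hFH hG
  obtain ⟨x, hxG, hx⟩ := hC.exists_relint hG.1.1 (hG.1.subset.trans hF.subset) hGspan
  -- If every side containing `G` contained `F`, one could move from `x` in direction `-y`, with `y
  -- ∈ F` off `G`, and stay in `F`, crossing the hyperplane that supports `G`.
  obtain ⟨T, hGT, hFT⟩ : ∃ T : Facet C, G ⊆ T.1 ∧ ¬ F ⊆ T.1 := by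
    by_contra! hcon
    obtain ⟨y, hyF, hyG⟩ : ∃ y ∈ F, y ∉ G := by
      by_contra! h
      rw [hG.1.subset.antisymm h] at hdim
      omega
    obtain ⟨ε, t, hε, ht, h⟩ := hC.exists_feasible (hF.subset (hG.1.subset hxG)) (d := -y)
      fun S hS => by
        have hGS : G ⊆ S.1 := by
          by_contra h
          exact (hx S h).ne hS
        rw [lorentz_neg_right, ((hC.mem_facet_iff S y).1 (hcon S hGS hyF)).2, neg_zero]
    have hF' := hF.mem_of_mem_span h (Submodule.smul_mem _ _ (Submodule.add_mem _
      (Submodule.subset_span (hG.1.subset hxG))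
      (Submodule.smul_mem _ _ (Submodule.neg_mem _ (Submodule.subset_span hyF)))))
    obtain ⟨⟨-, u, hu, rfl⟩, -⟩ := hG
    have h1 := hu _ hF'
    rw [lorentz_smul_right, lorentz_add_right, lorentz_smul_right, hxG.2, zero_add] at h1
    have h2 := nonpos_of_mul_nonpos_right (nonpos_of_mul_nonpos_right h1 ht) hε
    rw [lorentz_neg_right] at h2
    exact hyG ⟨hyF, le_antisymm (hu y hyF) (by linarith)⟩
  refine ⟨T, Set.Subset.antisymm ?_ fun y hy => ⟨hGT hy, hG.1.subset hy⟩⟩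
  have hlt : Submodule.span ℝ (T.1 ∩ F) < Submodule.span ℝ F := by
    refine lt_of_le_of_ne (Submodule.span_mono Set.inter_subset_right) fun h => hFT fun y hy => ?_
    refine (hC.mem_facet_iff T y).2 ⟨hF.subset hy, lorentz_eq_zero_of_mem_span (S := T.1 ∩ F)
      (fun z hz => ((hC.mem_facet_iff T z).1 hz.1).2) ?_⟩
    rw [h]
    exact Submodule.subset_span hy
  have hfin := Submodule.finrank_lt_finrank_of_lt hlt
  have heq := Submodule.eq_of_le_of_finrank_le
    (Submodule.span_mono (R := ℝ) (show G ⊆ T.1 ∩ F from fun y hy => ⟨hGT hy, hG.1.subset hy⟩))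
    (by omega)
  exact fun y hy => hGspan y (hF.subset hy.2) (heq ▸ Submodule.subset_span hy)

/-- Two sides that share a point are orthogonal. -/
theorem IsPolytope.normal_orthogonal_of_mem (hC : IsPolytope C) (hn : 2 ≤ n)
    (hR : IsRightAngled C) {S T : Facet C} (hST : S ≠ T) {y : Mink n} (hyS : y ∈ S.1)
    (hyT : y ∈ T.1) : lorentz (hC.normal S) (hC.normal T) = 0 := by
  by_cases h : -1 < lorentz (hC.normal S) (hC.normal T)
  · exact hC.normal_orthogonal_of_adjacent hR (hC.adjacent_of_lorentz_normal hn hR hST h)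
  exfalso
  obtain ⟨x, hxC, hx⟩ := hC.exists_normal_neg S
  have hne : hC.normal S + hC.normal T ≠ 0 := fun h0 => by
    have := congrArg (lorentz · x) h0
    simp only [lorentz_add_left, lorentz_zero_left] at this
    linarith [hC.normal_nonpos T hxC]
  -- The sum of the normals is orthogonal to the common point, so it is space-like, while a pairing
  -- of at most `-1` makes its square non-positive.
  have hpos := lorentz_self_pos_of_orthogonal (hC.subset_futureCone (S.subset hyS)).1
    (u := hC.normal S + hC.normal T) (by
      rw [lorentz_add_left, ((hC.mem_facet_iff S y).1 hyS).2, ((hC.mem_facet_iff T y).1 hyT).2,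
        zero_add]) hne
  simp only [lorentz_add_left, lorentz_add_right, hC.normal_self,
    lorentz_comm (hC.normal T) (hC.normal S)] at hpos
  linarith

/-- Every side containing `F` shares a point with `T`, so its normal is orthogonal to that of `T`;
the span of `F` is the common orthogonal complement of those normals. -/
theorem IsPolytope.normal_mem_span_face (hC : IsPolytope C) (hn : 2 ≤ n) (hR : IsRightAngled C)
    {F : Set (Mink n)} (hF : IsFace C F) {T : Facet C} (hne : (T.1 ∩ F).Nonempty)
    (hFT : ¬ F ⊆ T.1) : hC.normal T ∈ Submodule.span ℝ F := by
  obtain ⟨y, hyT, hyF⟩ := hne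
  refine hC.mem_span_face hF fun S hS => hC.normal_orthogonal_of_mem hn hR ?_ (hS hyF) hyT
  rintro rfl
  exact hFT hS

/-! ### The reflection groups of a polytope and of its faces. -/

/-- The outward normals of a right-angled polytope realize its right-angled Coxeter matrix. -/
theorem IsPolytope.isRightAngledSystem (hC : IsPolytope C) (hn : 2 ≤ n) (hR : IsRightAngled C) :
    IsRightAngledSystem (coxeterMatrix C) ⊤ hC.normal where
  mem _ := Submodule.mem_top
  unit := hC.normal_self
  rel S T hST := by
    by_cases h : Adjacent C S.1 T.1
    · exact Or.inr ⟨by simp [coxeterMatrix, hST, MeetAtRightAngle, h, hR S.1 T.1 S.2 T.2 h],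
        hC.normal_orthogonal_of_adjacent hR h⟩
    · refine Or.inl ⟨by simp [coxeterMatrix, hST, MeetAtRightAngle, h], ?_⟩
      by_contra! hc
      exact h (hC.adjacent_of_lorentz_normal hn hR hST hc)

/-- The vectors are unchanged; only the ambient subspace shrinks. Hence the group of a face has the
restricted Coxeter matrix. -/
theorem IsRightAngledSystem.restrict {B : Type*} {M : CoxeterMatrix B}
    {E E' : Submodule ℝ (Mink n)} {e : B → Mink n} (he : IsRightAngledSystem M E e) (A : Set B)
    (hA : ∀ a ∈ A, e a ∈ E') : IsRightAngledSystem (restrictMatrix M A) E' fun a => e a where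
  mem a := hA a a.2
  unit a := he.unit a
  rel a b hab := he.rel a b fun h => hab (Subtype.ext h)

theorem IsPolytope.isReflectionIn_facet_iff (hC : IsPolytope C) (S : Facet C)
    {g : Isom (hypSubspace (⊤ : Submodule ℝ (Mink n)))} :
    IsReflectionIn ⊤ S.1 g ↔
      g = reflIsom ⊤ (hC.normal S) Submodule.mem_top (hC.normal_self S) :=
  isReflectionIn_iff (Set.subset_univ _) (hC.exists_mem_facet_timelike S)
    (by rw [hC.finrank_span_facet, finrank_top, Module.finrank_fin_fun]) _ _
    (hC.isOutwardNormal_normal S).2.2.2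

/-- The reflection group of a right-angled polytope is its right-angled Coxeter group. -/
theorem IsPolytope.exists_coxeter_mulEquiv (hC : IsPolytope C) (hn : 2 ≤ n)
    (hR : IsRightAngled C) :
    ∃ φ : (coxeterMatrix C).Group ≃* Gam C, ∀ w,
      (φ w : Isom (hypSubspace (⊤ : Submodule ℝ (Mink n)))) =
        (hC.isRightAngledSystem hn hR).toIsom w := by
  -- An interior point of `C`, used as the base point for ping-pong.
  obtain ⟨x, hxC, hx⟩ := hC.exists_relint hC.nonempty subset_rfl fun _ h _ => h
  refine (hC.isRightAngledSystem hn hR).exists_mulEquiv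
    ((hC.isRightAngledSystem hn hR).toIsom_injective (hC.subset_hyperboloid hxC)
      Submodule.mem_top fun S => hx S fun h => ?_) ?_
  · obtain ⟨y, hy, hneg⟩ := hC.exists_normal_neg S
    exact hneg.ne ((hC.mem_facet_iff S y).1 (h hy)).2
  · rw [IsRightAngledSystem.range_toIsom]
    refine congrArg Subgroup.closure (Set.ext fun g => ?_)
    exact exists_congr fun S => eq_comm.trans (hC.isReflectionIn_facet_iff S).symm

/-- The sides of `C` that cut out the sides of a face `F`. -/
def facetsMeeting (C F : Set (Mink n)) : Set (Facet C) := {T | IsFacet F (T.1 ∩ F)}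

theorem IsPolytope.not_subset_of_mem_facetsMeeting (hC : IsPolytope C) {F : Set (Mink n)}
    (hF : IsFace C F) {T : Facet C} (hT : T ∈ facetsMeeting C F) : ¬ F ⊆ T.1 := fun h => by
  have := finrank_span_of_isFacet (hF.subset.trans hC.subset_hyperboloid) hT
  rw [Set.inter_eq_self_of_subset_right h] at this
  omega

theorem IsPolytope.normal_mem_of_mem_facetsMeeting (hC : IsPolytope C) (hn : 2 ≤ n)
    (hR : IsRightAngled C) {F : Set (Mink n)} (hF : IsFace C F) (T : Facet C)
    (hT : T ∈ facetsMeeting C F) : hC.normal T ∈ Submodule.span ℝ F :=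
  hC.normal_mem_span_face hn hR hF hT.1.1 (hC.not_subset_of_mem_facetsMeeting hF hT)

/-- The reflection group of a face is the right-angled Coxeter group of the sides of the polytope
that cut out the sides of the face. -/
theorem IsPolytope.exists_face_mulEquiv (hC : IsPolytope C) {F : Set (Mink n)}
    (hF : IsFace C F)
    (h : IsRightAngledSystem (restrictMatrix (coxeterMatrix C) (facetsMeeting C F))
      (Submodule.span ℝ F) fun T => hC.normal T) :
    ∃ ψ : (restrictMatrix (coxeterMatrix C) (facetsMeeting C F)).Group ≃* faceGroup F,
      ∀ w, (ψ w : Isom (hypSubspace (Submodule.span ℝ F))) = h.toIsom w := by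
  obtain ⟨x, hxF, hx⟩ := hC.exists_relint hF.1 hF.subset fun _ => hF.mem_of_mem_span
  have hFH := hF.subset.trans hC.subset_hyperboloid
  refine h.exists_mulEquiv (h.toIsom_injective (hFH hxF) (Submodule.subset_span hxF)
    fun T => hx T.1 (hC.not_subset_of_mem_facetsMeeting hF T.2)) ?_
  have hrefl : ∀ (T : Facet C) (hT : T ∈ facetsMeeting C F)
      (g : Isom (hypSubspace (Submodule.span ℝ F))), IsReflectionIn _ (T.1 ∩ F) g ↔
        g = reflIsom _ (hC.normal T) (h.mem ⟨T, hT⟩) (hC.normal_self T) := fun T hT g => by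
    refine isReflectionIn_iff (fun y hy => Submodule.subset_span hy.2) ?_
      (finrank_span_of_isFacet hFH hT) _ _ fun y hy => ((hC.mem_facet_iff T y).1 hy.1).2
    obtain ⟨y, hy⟩ := hT.1.1
    exact ⟨y, hy, (hC.subset_futureCone (hF.subset hy.2)).1⟩
  rw [IsRightAngledSystem.range_toIsom]
  refine congrArg Subgroup.closure (Set.Subset.antisymm ?_ ?_)
  · rintro _ ⟨⟨T, hT⟩, rfl⟩
    exact ⟨⟨T.1 ∩ F, hT⟩, (hrefl T hT _).2 rfl⟩
  · rintro g ⟨⟨G, hG⟩, hg⟩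
    obtain ⟨T, rfl⟩ := hC.exists_facet_inter hF hG
    exact ⟨⟨T, hG⟩, ((hrefl T hG g).1 hg).symm⟩

theorem special_eq_closure {M : CoxeterMatrix (Facet C)}
    (cs : CoxeterSystem M (Gam C))
    (h : ∀ (S : Facet C) (g : Gam C), IsReflectionIn ⊤ S.1 g.1 ↔ g = cs.simple S)
    (A : Set (Facet C)) : special C A = Subgroup.closure (cs.simple '' A) := by
  refine congrArg Subgroup.closure (Set.ext fun g => ⟨?_, ?_⟩)
  · rintro ⟨S, hS, hg⟩
    exact ⟨S, hS, ((h S g).1 hg).symm⟩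
  · rintro ⟨S, hS, rfl⟩
    exact ⟨S, hS, (h S _).2 rfl⟩

end HypPoly

theorem mainTheorem5 (n : ℕ) (hn : 2 < n) (C : Set (HypPoly.Mink n))
    (hC : HypPoly.IsPolytope C) (hR : HypPoly.IsRightAngled C) :
    -- the reflection group is the right-angled Coxeter group of the graph of sides
    (∃ φ : (HypPoly.coxeterMatrix C).Group ≃* HypPoly.Gam C, ∀ S : HypPoly.Facet C,
      HypPoly.IsReflectionIn ⊤ S.1
        (φ ((HypPoly.coxeterMatrix C).simple S) :
          HypPoly.Isom (HypPoly.hypSubspace (⊤ : Submodule ℝ (HypPoly.Mink n))))) ∧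
    -- the quotient by the normal closure of the complementary special subgroup
    (∀ A : Set (HypPoly.Facet C),
      (∃ e : (HypPoly.Gam C ⧸ Subgroup.normalClosure
              (HypPoly.special C Aᶜ : Set (HypPoly.Gam C))) ≃* HypPoly.special C A,
        ∀ g : HypPoly.special C A, e (QuotientGroup.mk (g : HypPoly.Gam C)) = g) ∧
      (∃ ρ : HypPoly.Gam C →* HypPoly.special C A,
        ∀ g : HypPoly.special C A, ρ (g : HypPoly.Gam C) = g)) ∧
    -- retraction onto the reflection group of a face
    (∀ F : Set (HypPoly.Mink n), HypPoly.IsFace C F → 2 ≤ HypPoly.hdim F →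
      ∃ (ι : HypPoly.faceGroup F →* HypPoly.Gam C) (ρ : HypPoly.Gam C →* HypPoly.faceGroup F),
        (∀ (g : HypPoly.faceGroup F) (x : HypPoly.hypSubspace (Submodule.span ℝ F)),
          (ι g).1.1 (HypPoly.toHyp x) = HypPoly.toHyp (g.1.1 x)) ∧
        ∀ g : HypPoly.faceGroup F, ρ (ι g) = g) := by
  have hn' : 2 ≤ n := hn.le
  have hsys := hC.isRightAngledSystem hn' hR
  obtain ⟨φ, hφ⟩ := hC.exists_coxeter_mulEquiv hn' hR
  have hM : ∀ S T, S ≠ T → HypPoly.coxeterMatrix C S T = 0 ∨ HypPoly.coxeterMatrix C S T = 2 :=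
    fun S T hST => (hsys.rel S T hST).imp And.left And.left
  have hrefl : ∀ S g, HypPoly.IsReflectionIn ⊤ S.1 (g : HypPoly.Gam C).1 ↔
      g = φ ((HypPoly.coxeterMatrix C).simple S) := fun S g => by
    rw [hC.isReflectionIn_facet_iff S, ← hsys.toIsom_simple, ← hφ]
    exact Subtype.ext_iff.symm
  refine ⟨⟨φ, fun S => (hrefl S _).2 rfl⟩, fun A => ?_, fun F hF _ => ?_⟩
  · set cs := (HypPoly.coxeterMatrix C).toCoxeterSystem.map φ with hcs
    have hsimple : ∀ S, cs.simple S = φ ((HypPoly.coxeterMatrix C).simple S) := fun S => by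
      rw [hcs, CoxeterSystem.map_simple, CoxeterMatrix.toCoxeterSystem_simple]
    have hspecial := HypPoly.special_eq_closure cs fun S g => by rw [hrefl, hsimple]
    obtain ⟨ρ, hρ, -⟩ := HypPoly.exists_special_retraction cs hM (hspecial A)
    exact ⟨HypPoly.exists_special_quotient cs hM (hspecial A) (hspecial Aᶜ), ρ, hρ⟩
  · have hsysF := hsys.restrict (HypPoly.facetsMeeting C F)
      (hC.normal_mem_of_mem_facetsMeeting hn' hR hF)
    obtain ⟨ψ, hψ⟩ := hC.exists_face_mulEquiv hF hsysF
    obtain ⟨j, r, hj, hrj⟩ :=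
      HypPoly.exists_restrict_retraction hM (HypPoly.facetsMeeting C F)
    -- On a generator both actions are the same linear reflection, in the normal of `T`; words
    -- follow by induction.
    have hcompat : ∀ w (x : HypPoly.hypSubspace (Submodule.span ℝ F)),
        (hsys.toIsom (j w)).1 (HypPoly.toHyp x) = HypPoly.toHyp ((hsysF.toIsom w).1 x) := by
      intro w
      induction w using (HypPoly.restrictMatrix (HypPoly.coxeterMatrix C)
        (HypPoly.facetsMeeting C F)).toCoxeterSystem.simple_induction_left with
      | one =>
        intro x
        simp only [map_one]
        rfl
      | mul_simple_left w T ih =>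
        intro x
        rw [CoxeterMatrix.toCoxeterSystem_simple]
        simp only [map_mul, hj, hsys.toIsom_simple, hsysF.toIsom_simple]
        exact Subtype.ext
          (congrArg (HypPoly.reflect (hC.normal T)) (congrArg Subtype.val (ih x)))
    refine ⟨(φ.toMonoidHom.comp j).comp ψ.symm.toMonoidHom,
      (ψ.toMonoidHom.comp r).comp φ.symm.toMonoidHom, fun g x => ?_, fun g => ?_⟩
    · obtain ⟨w, rfl⟩ := ψ.surjective g
      have h1 : ((φ.toMonoidHom.comp j).comp ψ.symm.toMonoidHom) (ψ w) = φ (j w) := by simp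
      rw [h1, hφ, hψ, hcompat]
    · simp [hrj]
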